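/- **Setting.** Let $\mathcal P,\mathcal H,\mathcal M,\mathcal Q$ be real Hilbert spaces, where $\mathcal P\hookrightarrow\mathcal H$ is a continuous dense embedding, so that $\mathcal P\hookrightarrow\mathcal H\cong\mathcal H^*\hookrightarrow\mathcal P^*$ is a Gelfand triple, and where $\mathcal M$ is identified with $\mathcal M^*$. Let $\mathcal A\colon\mathcal H\to\mathcal H^*$, $\mathcal K\colon\mathcal P\to\mathcal M^*$, $\mathcal D\colon\mathcal M\to\mathcal M^*$ and $\mathcal B\colon\mathcal P\to\mathcal Q^*$ be linear and bounded, and write $\mathcal P_{\ker}=\ker\mathcal B$ and $\mathcal H_{\ker}$ for the closure of $\mathcal P_{\ker}$ in $\mathcal H$. Assume that there are constants $c_{\mathcal D},\beta,c_{\mathcal K}>0$ with $$\langle\mathcal D x,x\rangle\ge c_{\mathcal D}\|x\|_{\mathcal M}^2\ \ (x\in\mathcal M),\qquad \inf_{\mu\in\mathcal Q\setminus\{0\}}\ \sup_{q\in\mathcal P\setminus\{0\}}\frac{\langle\mathcal B q,\mu\rangle}{\|q\|_{\mathcal P}\|\mu\|_{\mathcal Q}}\ge\beta,\qquad \|\mathcal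 K q\|_{\mathcal M^*}\ge c_{\mathcal K}\|q\|_{\mathcal P}\ \ (q\in\mathcal P_{\ker}).$$ Let $\mathcal B^-\colon\mathcal Q^*\to\mathcal P$ be the right inverse of $\mathcal B$ with values in the orthogonal complement of $\mathcal P_{\ker}$ in $\mathcal P$. Let $T>0$ and $\varepsilon>0$, and consider $$\dot p+\mathcal A p-\mathcal K^*m+\mathcal B^*\lambda=g\ \text{ in }\mathcal P^*,\qquad \varepsilon\dot m+\mathcal K p+\mathcal D m=f\ \text{ in }\mathcal M^*,\qquad \mathcal B p=h\ \text{ in }\mathcal Q^*\qquad(*)$$ with initial values $p(0)$ and $m(0)$. **Mild solutions.** A triple $(p,m,\lambda)$ is a *mild solution* of $(*)$ if $p\in C([0,T],\mathcal H)$ and $m\in C([0,T],\mathcal M)$ attain the initial values, if for every $t\in[0,T]$ the integral $\int_0^t p\,ds$ (taken in $\mathcal H$) belongs to $\mathcal P$ and $$\begin{aligned}\Big(p(t)-p(0),q\Big)_{\mathcal H}+\Big\langle\mathcal A\int_0^t p\,ds,\,q\Big\rangle-\Big\langle\mathcal K q,\int_0^t m\,ds\Big\rangle&=\Big\langle\int_0^t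 g\,ds,\,q\Big\rangle\quad\text{for all }q\in\mathcal P_{\ker},\\ \varepsilon\,(m(t)-m(0))+\mathcal K\int_0^t p\,ds+\mathcal D\int_0^t m\,ds&=\int_0^t f\,ds\quad\text{in }\mathcal M^*,\\ \mathcal B\int_0^t p\,ds&=\int_0^t h\,ds\quad\text{in }\mathcal Q^*,\end{aligned}$$ and if $\lambda$ is a $\mathcal Q$-valued distribution on $(0,T)$ such that the first equation of $(*)$ holds in the sense of $\mathcal P^*$-valued distributions on $(0,T)$. **Proposition (existence of a mild solution).** Let $f\in L^2(0,T;\mathcal M^*)$, $g=g_1+g_2$ with $g_1\in H^1(0,T;\mathcal P^*)$ and $g_2\in L^2(0,T;\mathcal H^*)$, and $h\in H^1(0,T;\mathcal Q^*)$ (with $h(0)$ the value at $0$ of its continuous representative). Let $p(0)\in\mathcal H$ be consistent, i.e. $p(0)-\mathcal B^-h(0)\in\mathcal H_{\ker}$, and let $m(0)\in\mathcal M$. Then there is a unique mild solution $(p,m,\lambda)$ of $(*)$, and $$p\in C([0,T],\mathcal H)\cap H^1(0,T;\mathcal P_{\ker}^*),\qquad m\in C([0,T],\mathcal M).$$ Moreover,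 the distribution $\lambda$ is the distributional derivative of a function in $C([0,T],\mathcal Q)$, and $\dot p+\mathcal B^*\lambda\in L^2(0,T;\mathcal P^*)$. -/

import Mathlib

open MeasureTheory TopologicalSpace
open scoped Distributions InnerProductSpace

namespace PDAE

noncomputable section

/-- The open time interval `(0, T)`. -/
def timeInterval (T : ℝ) : Opens ℝ := ⟨Set.Ioo 0 T, isOpen_Ioo⟩

section Bochner

variable {X : Type*} [NormedAddCommGroup X] [NormedSpace ℝ X]

/-- `u ∈ L²(0, T; X)`, in the Bochner sense. -/
def MemL2 (T : ℝ) (u : ℝ → X) : Prop :=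
  MemLp u 2 (volume.restrict (Set.Ioo 0 T))

/-- `v` is a weak derivative of `u` on `(0, T)`. -/
def HasWeakDeriv (T : ℝ) (u v : ℝ → X) : Prop :=
  ∀ φ : 𝓓(timeInterval T, ℝ),
    (∫ t in (0 : ℝ)..T, deriv φ t • u t) = -∫ t in (0 : ℝ)..T, φ t • v t

/-- `u ∈ H¹(0, T; X)`: `u` and its weak derivative are square integrable on `(0, T)`. -/
def MemH1 (T : ℝ) (u : ℝ → X) : Prop :=
  MemL2 T u ∧ ∃ v : ℝ → X, MemL2 T v ∧ HasWeakDeriv T u v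

/-- The `X`-valued distribution `lam` on `(0, T)` is the distributional derivative of `Lam`. -/
def IsDistribDeriv (T : ℝ) (lam : 𝓓'(timeInterval T, X)) (Lam : ℝ → X) : Prop :=
  ∀ φ : 𝓓(timeInterval T, ℝ), lam φ = -∫ t in (0 : ℝ)..T, deriv φ t • Lam t

end Bochner

section Spaces

variable {P H M Q : Type*}
  [NormedAddCommGroup P] [InnerProductSpace ℝ P]
  [NormedAddCommGroup H] [InnerProductSpace ℝ H]
  [NormedAddCommGroup M] [InnerProductSpace ℝ M]
  [NormedAddCommGroup Q] [InnerProductSpace ℝ Q]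

/-- The embedding `H ≅ H* ↪ P*` of the Gelfand triple: `x ↦ (x, j ·)_H`. -/
def pivot (j : P →L[ℝ] H) (x : H) : StrongDual ℝ P := (innerSL ℝ x).comp j

/-- `P_ker = ker B`. -/
def kerB (B : P →L[ℝ] StrongDual ℝ Q) : Submodule ℝ P := LinearMap.ker B.toLinearMap

/-- `H_ker`, the closure of `P_ker` in `H`. -/
def hKer (j : P →L[ℝ] H) (B : P →L[ℝ] StrongDual ℝ Q) : Submodule ℝ H :=
  ((kerB B).map j.toLinearMap).topologicalClosure

/-- Inf-sup stability of `B` with a constant at least `β`. -/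
def InfSup (B : P →L[ℝ] StrongDual ℝ Q) (β : ℝ) : Prop :=
  ∀ μ : Q, μ ≠ 0 → β ≤ ⨆ q : {q : P // q ≠ 0}, B q μ / (‖(q : P)‖ * ‖μ‖)

/-- The right inverse `B⁻ : Q* → P` with values in the orthogonal complement of `ker B`: the unique
preimage under `B` there (which exists whenever `B` is inf-sup stable). -/
def rightInv (B : P →L[ℝ] StrongDual ℝ Q) (η : StrongDual ℝ Q) : P :=
  (Function.invFun (fun q : (kerB B)ᗮ => B (q : P)) η : (kerB B)ᗮ)

/-- Mild solutions of
`p' + A p - K* m + B* λ = g` in `P*`, `ε m' + K p + D m = f` in `M*`, `B p = h` in `Q*`.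

Here `p`, `m` are continuous and satisfy the equations after integration over `(0, t)`, where the
first equation is tested with `P_ker` (this removes `λ`); the integral of `p`, taken in `H`, has to
lie in `P`, since `K` and `B` are defined there only. The multiplier is a `Q`-valued
distribution on `(0, T)` such that the first equation, tested with all of `P`, holds in the
sense of distributions. -/
structure IsMildSolution (T ε : ℝ) (j : P →L[ℝ] H) (A : H →L[ℝ] StrongDual ℝ H)
    (K : P →L[ℝ] StrongDual ℝ M) (D : M →L[ℝ] StrongDual ℝ M) (B : P →L[ℝ] StrongDual ℝ Q)
    (f : ℝ → StrongDual ℝ M) (g : ℝ → StrongDual ℝ P) (h : ℝ → StrongDual ℝ Q)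
    (p₀ : H) (m₀ : M) (p : ℝ → H) (m : ℝ → M) (lam : 𝓓'(timeInterval T, Q)) : Prop where
  continuousOn_p : ContinuousOn p (Set.Icc 0 T)
  continuousOn_m : ContinuousOn m (Set.Icc 0 T)
  initial_p : p 0 = p₀
  initial_m : m 0 = m₀
  /-- the equations integrated over `(0, t)`, with `Pt` the integral of `p` -/
  integrated : ∀ t ∈ Set.Icc 0 T, ∃ Pt : P,
    j Pt = (∫ s in (0 : ℝ)..t, p s) ∧
    (∀ q ∈ kerB B,
      ⟪p t - p₀, j q⟫_ℝ + A (∫ s in (0 : ℝ)..t, p s) (j q) - K q (∫ s in (0 : ℝ)..t, m s)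
        = (∫ s in (0 : ℝ)..t, g s) q) ∧
    ε • innerSL ℝ (m t - m₀) + K Pt + D (∫ s in (0 : ℝ)..t, m s) = (∫ s in (0 : ℝ)..t, f s) ∧
    B Pt = ∫ s in (0 : ℝ)..t, h s
  /-- the first equation in the space of `P*`-valued distributions -/
  multiplier : ∀ φ : 𝓓(timeInterval T, ℝ),
    -(∫ t in (0 : ℝ)..T, deriv φ t • pivot j (p t))
      + (∫ t in (0 : ℝ)..T, φ t • ((A (p t)).comp j - K.flip (m t)))
      + B.flip (lam φ)
      = ∫ t in (0 : ℝ)..T, φ t • g t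

end Spaces

end

end PDAE

/-! The system is reduced to one equation x' + S x + L x = F in a Hilbert space, with S skew-adjoint
and L bounded, and that equation is solved by energy estimates.

Reduction (`exists_integrated`, `exists_mild_homogeneous`): by inf-sup stability B has a bounded
right inverse, and subtracting a lift of h makes the constraint homogeneous at the price of data in
h and h'. The part g₁ is only P*-valued, too rough for an energy estimate in H. Since K is bounded
below on ker B, g₁ acts there as K* of an M-valued function, which is merged into m; its derivative
moves to the second equation, which is why g₁ is taken in H¹. Scaling m by √ε makes the coupling
skew.

Skew-adjointness (`isSkewAdjointRel_saddleRel`): the lower bound on K gives q ↦ (j q, k q) closed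
range on ker B. As j(ker B) need not be dense in H, S is a linear relation with multivalued part
H_ker^⊥ × 0, and consistency says that the initial value is orthogonal to it.

Solution (`IsSkewAdjointRel.exists_mild`): S drops out of the energy balance, so classical solutions
are controlled uniformly in time by their data. An element orthogonal to all such data solves the
backward adjoint problem weakly, so its source part vanishes and its initial part is multivalued
(`mem_closure_classicalData`). Hence all consistent data are limits of classical data, and the
limits of the solutions satisfy the integrated equation.

Uniqueness (`eqOn_of_integrated`) is the energy argument for the time integrals of a difference,
whose p-part lies in ker B. The time-integrated residual of the first equation vanishes on ker B, so
it is B*Λ with Λ continuous, and λ = Λ'; λ is unique because B* is injective. -/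

namespace PDAE

/-! ### Primitives, weak derivatives and test functions -/

section Primitives

set_option linter.unusedSectionVars false

variable {X : Type*} [NormedAddCommGroup X] [NormedSpace ℝ X]

/-- Integration by parts against a primitive of a merely integrable function. -/
theorem integral_smul_eq_add_integral_smul_integral [CompleteSpace X] {a b : ℝ} (hab : a ≤ b)
    {φ φ' : ℝ → ℝ} (hφ : ∀ t, HasDerivAt φ (φ' t) t) (hφ' : Continuous φ')
    {G : ℝ → X} (hG : IntervalIntegrable G volume a b) :
    ∫ s in a..b, φ s • G s
      = φ a • (∫ s in a..b, G s) + ∫ t in a..b, φ' t • ∫ s in t..b, G s := by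
  have hG' : Integrable G (volume.restrict (Set.Ioc a b)) :=
    (intervalIntegrable_iff_integrableOn_Ioc_of_le hab).1 hG
  have hd : Integrable φ' (volume.restrict (Set.Ioc a b)) :=
    (intervalIntegrable_iff_integrableOn_Ioc_of_le hab).1 (hφ'.intervalIntegrable a b)
  have hφc : Continuous φ := continuous_iff_continuousAt.2 fun t => (hφ t).continuousAt
  have h1 : ∀ s, φ s = φ a + ∫ t in a..s, φ' t := fun s => by
    rw [intervalIntegral.integral_eq_sub_of_hasDerivAt (fun t _ => hφ t)
      (hφ'.intervalIntegrable _ _)]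
    ring
  have hmeas : MeasurableSet {z : ℝ × ℝ | z.1 ≤ z.2} := measurableSet_le measurable_fst measurable_snd
  -- With φ s - φ a written as the integral of φ', the claim is Fubini on the triangle t ≤ s, so no
  -- derivative of a primitive of G is needed.
  have hint : Integrable (Function.uncurry fun t s : ℝ =>
      {z : ℝ × ℝ | z.1 ≤ z.2}.indicator (fun z => φ' z.1 • G z.2) (t, s))
      ((volume.restrict (Set.Ioc a b)).prod (volume.restrict (Set.Ioc a b))) :=
    (hd.smul_prod hG').indicator hmeas
  have hswap := integral_integral_swap hint
  have hL : ∀ t ∈ Set.Ioc a b, ∫ s in Set.Ioc a b,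
      {z : ℝ × ℝ | z.1 ≤ z.2}.indicator (fun z => φ' z.1 • G z.2) (t, s)
        = φ' t • ∫ s in t..b, G s := by
    intro t ht
    have : (fun s => {z : ℝ × ℝ | z.1 ≤ z.2}.indicator (fun z => φ' z.1 • G z.2) (t, s))
        = (Set.Ici t).indicator (fun s => φ' t • G s) := by
      ext s
      simp [Set.indicator]
    rw [this, setIntegral_indicator measurableSet_Ici, intervalIntegral.integral_of_le ht.2,
      integral_smul]
    congr 1
    have hset : Set.Ioc a b ∩ Set.Ici t = Set.Icc t b := by
      ext s
      simp only [Set.mem_inter_iff, Set.mem_Ioc, Set.mem_Ici, Set.mem_Icc]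
      exact ⟨fun h => ⟨h.2, h.1.2⟩, fun h => ⟨⟨ht.1.trans_le h.1, h.2⟩, h.1⟩⟩
    rw [hset, integral_Icc_eq_integral_Ioc]
  have hR : ∀ s ∈ Set.Ioc a b, ∫ t in Set.Ioc a b,
      {z : ℝ × ℝ | z.1 ≤ z.2}.indicator (fun z => φ' z.1 • G z.2) (t, s)
        = (φ s - φ a) • G s := by
    intro s hs
    have : (fun t => {z : ℝ × ℝ | z.1 ≤ z.2}.indicator (fun z => φ' z.1 • G z.2) (t, s))
        = (Set.Iic s).indicator (fun t => φ' t • G s) := by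
      ext t
      simp [Set.indicator]
    rw [this, setIntegral_indicator measurableSet_Iic]
    have hset : Set.Ioc a b ∩ Set.Iic s = Set.Ioc a s := by
      ext t
      simp only [Set.mem_inter_iff, Set.mem_Ioc, Set.mem_Iic]
      exact ⟨fun h => ⟨h.1.1, h.2⟩, fun h => ⟨⟨h.1, h.2.trans hs.2⟩, h.2⟩⟩
    rw [hset, integral_smul_const, ← intervalIntegral.integral_of_le hs.1.le, h1 s]
    simp
  rw [setIntegral_congr_fun measurableSet_Ioc hL, setIntegral_congr_fun measurableSet_Ioc hR,
    ← intervalIntegral.integral_of_le hab, ← intervalIntegral.integral_of_le hab] at hswap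
  rw [hswap, ← intervalIntegral.integral_smul, ← intervalIntegral.integral_add
    (f := fun s => φ a • G s) (g := fun s => (φ s - φ a) • G s)
    (hG.smul (φ a)) (hG.continuousOn_smul (hφc.sub continuous_const).continuousOn)]
  simp only [← add_smul, add_sub_cancel]

theorem testFunction_eq_zero {T t : ℝ} (φ : 𝓓(timeInterval T, ℝ)) (ht : t ∉ Set.Ioo 0 T) :
    φ t = 0 :=
  image_eq_zero_of_notMem_tsupport fun h => ht (φ.tsupport_subset h)

theorem testFunction_hasDerivAt {T : ℝ} (φ : 𝓓(timeInterval T, ℝ)) (t : ℝ) :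
    HasDerivAt φ (deriv φ t) t :=
  (φ.contDiff.differentiable (by simp)).differentiableAt.hasDerivAt

theorem testFunction_continuous_deriv {T : ℝ} (φ : 𝓓(timeInterval T, ℝ)) :
    Continuous (deriv φ) :=
  φ.contDiff.continuous_deriv (by simp)

theorem integral_deriv_testFunction {T : ℝ} (φ : 𝓓(timeInterval T, ℝ)) (a b : ℝ) :
    ∫ t in a..b, deriv φ t = φ b - φ a :=
  intervalIntegral.integral_eq_sub_of_hasDerivAt (fun t _ => testFunction_hasDerivAt φ t)
    ((testFunction_continuous_deriv φ).intervalIntegrable _ _)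

/-- A primitive `c + ∫₀ᵗ v` has the weak derivative `v`. -/
theorem hasWeakDeriv_of_eqOn [CompleteSpace X] {T : ℝ} (hT : 0 < T) {u v : ℝ → X} {c : X}
    (hv : IntervalIntegrable v volume 0 T)
    (hu : ∀ᵐ t ∂volume.restrict (Set.Ioo 0 T), u t = c + ∫ s in (0 : ℝ)..t, v s) :
    HasWeakDeriv T u v := by
  intro φ
  have h1 := integral_smul_eq_add_integral_smul_integral hT.le (testFunction_hasDerivAt φ)
    (testFunction_continuous_deriv φ) hv
  rw [testFunction_eq_zero φ (by simp : (0 : ℝ) ∉ Set.Ioo 0 T), zero_smul, zero_add] at h1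
  have h2 : ∫ t in (0 : ℝ)..T, deriv φ t • u t
      = ∫ t in (0 : ℝ)..T, (deriv φ t • (c + ∫ s in (0 : ℝ)..T, v s)
        - deriv φ t • ∫ s in t..T, v s) := by
    rw [intervalIntegral.integral_of_le hT.le, intervalIntegral.integral_of_le hT.le,
      ← restrict_Ioo_eq_restrict_Ioc]
    refine integral_congr_ae ?_
    filter_upwards [hu, ae_restrict_mem measurableSet_Ioo] with t ht htm
    have hsub : ∀ x ∈ Set.Icc 0 T, ∀ y ∈ Set.Icc 0 T, IntervalIntegrable v volume x y :=
      fun x hx y hy => hv.mono_set (Set.uIcc_subset_uIcc (by rwa [Set.uIcc_of_le hT.le])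
        (by rwa [Set.uIcc_of_le hT.le]))
    have h0 : (0 : ℝ) ∈ Set.Icc 0 T := ⟨le_rfl, hT.le⟩
    have h3 : T ∈ Set.Icc 0 T := ⟨hT.le, le_rfl⟩
    have htm' : t ∈ Set.Icc 0 T := ⟨htm.1.le, htm.2.le⟩
    rw [ht, ← intervalIntegral.integral_add_adjacent_intervals (hsub 0 h0 t htm')
      (hsub t htm' T h3), ← smul_sub]
    congr 1
    abel
  have hcont : ContinuousOn (fun t => ∫ s in t..T, v s) (Set.uIcc 0 T) := by
    have := intervalIntegral.continuousOn_primitive_interval' hv.symm Set.left_mem_uIcc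
    rw [Set.uIcc_comm] at this
    exact this.neg.congr fun t _ => intervalIntegral.integral_symm T t
  rw [h2, intervalIntegral.integral_sub, intervalIntegral.integral_smul_const,
    integral_deriv_testFunction, h1, testFunction_eq_zero φ (by simp : T ∉ Set.Ioo 0 T),
    testFunction_eq_zero φ (by simp : (0 : ℝ) ∉ Set.Ioo 0 T)]
  · simp
  · exact ((testFunction_continuous_deriv φ).smul continuous_const).intervalIntegrable _ _
  · exact ((testFunction_continuous_deriv φ).continuousOn.smul hcont).intervalIntegrable

theorem MemL2.intervalIntegrable {T : ℝ} (hT : 0 < T) {u : ℝ → X} (hu : MemL2 T u) :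
    IntervalIntegrable u volume 0 T := by
  rw [intervalIntegrable_iff_integrableOn_Ioo_of_le hT.le]
  exact MemLp.integrable one_le_two hu

theorem intervalIntegrable_of_mem_Icc {T : ℝ} {u : ℝ → X} (hu : IntervalIntegrable u volume 0 T)
    {a b : ℝ} (ha : a ∈ Set.Icc 0 T) (hb : b ∈ Set.Icc 0 T) : IntervalIntegrable u volume a b := by
  have hT : 0 ≤ T := ha.1.trans ha.2
  exact hu.mono_set (Set.uIcc_subset_uIcc (by rwa [Set.uIcc_of_le hT])
        (by rwa [Set.uIcc_of_le hT]))

theorem continuousOn_integral_Icc {T : ℝ} {u : ℝ → X} (hT : 0 < T)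
    (hu : IntervalIntegrable u volume 0 T) :
    ContinuousOn (fun t => ∫ s in (0 : ℝ)..t, u s) (Set.Icc 0 T) := by
  have := intervalIntegral.continuousOn_primitive_interval' hu Set.left_mem_uIcc
  rwa [Set.uIcc_of_le hT.le] at this

theorem hasDerivAt_integral_of_continuousOn [CompleteSpace X] {T t : ℝ} {u : ℝ → X}
    (hu : ContinuousOn u (Set.Icc 0 T)) (ht : t ∈ Set.Ioo 0 T) :
    HasDerivAt (fun t => ∫ s in (0 : ℝ)..t, u s) (u t) t := by
  have hnhds : Set.Icc 0 T ∈ nhds t := Icc_mem_nhds ht.1 ht.2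
  refine intervalIntegral.integral_hasDerivAt_right ?_ ?_ (hu.continuousAt hnhds)
  · refine ContinuousOn.intervalIntegrable (hu.mono ?_)
    rw [Set.uIcc_of_le ht.1.le]
    exact Set.Icc_subset_Icc_right ht.2.le
  · exact ⟨Set.Icc 0 T, hnhds, hu.aestronglyMeasurable measurableSet_Icc⟩

theorem memL2_of_continuousOn {T : ℝ} {u : ℝ → X} (hu : ContinuousOn u (Set.Icc 0 T)) :
    MemL2 T u := by
  obtain ⟨C, hC⟩ := isCompact_Icc.exists_bound_of_continuousOn hu
  refine MemLp.of_bound ((hu.mono Set.Ioo_subset_Icc_self).aestronglyMeasurable measurableSet_Ioo)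
    C ?_
  filter_upwards [ae_restrict_mem measurableSet_Ioo] with t ht
  exact hC t ⟨ht.1.le, ht.2.le⟩

/-- A test function with vanishing mean has a primitive that is a test function. -/
theorem exists_testFunction_deriv_eq {T : ℝ} (ψ : 𝓓(timeInterval T, ℝ))
    (h0 : ∫ t in (0 : ℝ)..T, ψ t = 0) : ∃ φ : 𝓓(timeInterval T, ℝ), deriv φ = ψ := by
  have hψ := ψ.continuous
  have hder : ∀ t, HasDerivAt (fun t => ∫ s in (0 : ℝ)..t, ψ s) (ψ t) t := fun t =>
    intervalIntegral.integral_hasDerivAt_right (hψ.intervalIntegrable _ _)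
      (hψ.stronglyMeasurableAtFilter _ _) hψ.continuousAt
  have hder' : deriv (fun t => ∫ s in (0 : ℝ)..t, ψ s) = ψ := funext fun t => (hder t).deriv
  rcases (tsupport ψ).eq_empty_or_nonempty with hemp | hne
  · refine ⟨0, ?_⟩
    have : (ψ : ℝ → ℝ) = 0 := tsupport_eq_empty_iff.1 hemp
    rw [this]
    exact funext fun t => deriv_const t 0
  obtain ⟨c, hc, hcl⟩ := (show IsCompact (tsupport ψ) from ψ.hasCompactSupport).exists_isLeast hne
  obtain ⟨d, hd, hdl⟩ :=
    (show IsCompact (tsupport ψ) from ψ.hasCompactSupport).exists_isGreatest hne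
  have hc' : c ∈ Set.Ioo 0 T := ψ.tsupport_subset hc
  have hd' : d ∈ Set.Ioo 0 T := ψ.tsupport_subset hd
  -- The primitive vanishes before the support of ψ begins and, by the zero mean, after it ends. Its
  -- support thus lies in the hull [c, d], a compact part of (0, T).
  have hlow : ∀ t < c, ∫ s in (0 : ℝ)..t, ψ s = 0 := by
    intro t ht
    refine intervalIntegral.integral_zero_ae (ae_of_all _ fun s hs => ?_)
    refine image_eq_zero_of_notMem_tsupport fun hmem => ?_
    have h1 := hcl hmem
    rcases Set.mem_uIoc.1 hs with h | h
    · linarith [h.2]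
    · linarith [h.2, hc'.1]
  have hhigh : ∀ t > d, ∫ s in (0 : ℝ)..t, ψ s = 0 := by
    intro t ht
    rw [← intervalIntegral.integral_add_adjacent_intervals (hψ.intervalIntegrable 0 T)
      (hψ.intervalIntegrable T t), h0, zero_add]
    refine intervalIntegral.integral_zero_ae (ae_of_all _ fun s hs => ?_)
    refine image_eq_zero_of_notMem_tsupport fun hmem => ?_
    have h1 := hdl hmem
    rcases Set.mem_uIoc.1 hs with h | h
    · linarith [h.1, hd'.2]
    · linarith [h.1]
  have hsupp : tsupport (fun t => ∫ s in (0 : ℝ)..t, ψ s) ⊆ Set.Icc c d := by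
    refine closure_minimal (fun t ht => ?_) isClosed_Icc
    by_contra hcd
    rw [Set.mem_Icc, not_and_or, not_le, not_le] at hcd
    exact ht (hcd.elim (hlow t) (hhigh t))
  refine ⟨⟨fun t => ∫ s in (0 : ℝ)..t, ψ s, ?_, ?_, ?_⟩, hder'⟩
  · refine contDiff_infty_iff_deriv.2 ⟨fun t => (hder t).differentiableAt, ?_⟩
    rw [hder']
    exact ψ.contDiff
  · exact isCompact_Icc.of_isClosed_subset (isClosed_tsupport _) hsupp
  · exact hsupp.trans fun t ht => ⟨hc'.1.trans_le ht.1, ht.2.trans_lt hd'.2⟩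

theorem exists_testFunction_integral_eq_one {T : ℝ} (hT : 0 < T) :
    ∃ χ : 𝓓(timeInterval T, ℝ), ∫ t in (0 : ℝ)..T, χ t = 1 := by
  obtain ⟨f, hf, hfc, hfd, hfr, hf1⟩ := exists_contDiff_tsupport_subset (n := ⊤)
    (isOpen_Ioo.mem_nhds (show T / 2 ∈ Set.Ioo 0 T from ⟨by linarith, by linarith⟩))
  let χ : 𝓓(timeInterval T, ℝ) := ⟨f, hfd, hfc, hf⟩
  have hpos : 0 < ∫ t in (0 : ℝ)..T, χ t :=
    intervalIntegral.integral_pos hT χ.continuous.continuousOn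
      (fun t _ => (hfr ⟨t, rfl⟩).1)
      ⟨T / 2, ⟨by linarith, by linarith⟩, by change 0 < f (T / 2); rw [hf1]; exact one_pos⟩
  refine ⟨(∫ t in (0 : ℝ)..T, χ t)⁻¹ • χ, ?_⟩
  change ∫ t in (0 : ℝ)..T, (∫ t in (0 : ℝ)..T, χ t)⁻¹ * χ t = 1
  rw [intervalIntegral.integral_const_mul, inv_mul_cancel₀ hpos.ne']

/-- A locally integrable function that annihilates all test functions vanishes. -/
theorem ae_eq_zero_of_integral_testFunction_smul [CompleteSpace X] {T : ℝ} (hT : 0 < T)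
    {w : ℝ → X} (hw : IntervalIntegrable w volume 0 T)
    (h : ∀ φ : 𝓓(timeInterval T, ℝ), ∫ t in (0 : ℝ)..T, φ t • w t = 0) :
    ∀ᵐ t ∂volume.restrict (Set.Ioo 0 T), w t = 0 := by
  rw [ae_restrict_iff' measurableSet_Ioo]
  refine isOpen_Ioo.ae_eq_zero_of_integral_contDiff_smul_eq_zero ?_ fun g hg hgc hgs => ?_
  · exact ((intervalIntegrable_iff_integrableOn_Ioo_of_le hT.le).1 hw).locallyIntegrableOn
  · let φ : 𝓓(timeInterval T, ℝ) := ⟨g, hg, hgc, hgs⟩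
    rw [← h φ, intervalIntegral.integral_of_le hT.le, ← restrict_Ioo_eq_restrict_Ioc,
      setIntegral_eq_integral_of_forall_compl_eq_zero]
    · rfl
    · intro t ht
      rw [testFunction_eq_zero φ ht, zero_smul]

/-- A function with an integrable weak derivative `v` agrees with a primitive of `v`. -/
theorem HasWeakDeriv.ae_eq_add_integral [CompleteSpace X] {T : ℝ} (hT : 0 < T) {u v : ℝ → X}
    (hu : IntervalIntegrable u volume 0 T) (hv : IntervalIntegrable v volume 0 T)
    (h : HasWeakDeriv T u v) :
    ∃ c : X, ∀ᵐ t ∂volume.restrict (Set.Ioo 0 T), u t = c + ∫ s in (0 : ℝ)..t, v s := by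
  obtain ⟨χ, hχ⟩ := exists_testFunction_integral_eq_one hT
  have hp : IntervalIntegrable (fun t => ∫ s in (0 : ℝ)..t, v s) volume 0 T :=
    (intervalIntegral.continuousOn_primitive_interval' hv Set.left_mem_uIcc).intervalIntegrable
  have hw : IntervalIntegrable (fun t => u t - ∫ s in (0 : ℝ)..t, v s) volume 0 T := hu.sub hp
  set w : ℝ → X := fun t => u t - ∫ s in (0 : ℝ)..t, v s with hwdef
  have hsm : ∀ φ : ℝ → ℝ, Continuous φ → ∀ f : ℝ → X, IntervalIntegrable f volume 0 T →
      IntervalIntegrable (fun t => φ t • f t) volume 0 T := fun φ hφ f hf =>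
    hf.continuousOn_smul hφ.continuousOn
  have hderiv : ∀ φ : 𝓓(timeInterval T, ℝ), ∫ t in (0 : ℝ)..T, deriv φ t • w t = 0 := by
    intro φ
    have h2 : HasWeakDeriv T (fun t => ∫ s in (0 : ℝ)..t, v s) v :=
      hasWeakDeriv_of_eqOn hT (c := 0) hv (ae_of_all _ fun t => (zero_add _).symm)
    have hc := testFunction_continuous_deriv φ
    simp only [hwdef, smul_sub]
    rw [intervalIntegral.integral_sub (hsm _ hc _ hu) (hsm _ hc _ hp), h φ, h2 φ, sub_self]
  refine ⟨∫ t in (0 : ℝ)..T, χ t • w t, ?_⟩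
  -- Du Bois-Reymond: ψ minus its mean times χ is the derivative of a test function, which w
  -- annihilates. So w minus the constant ∫ χ w annihilates every ψ.
  have key := ae_eq_zero_of_integral_testFunction_smul hT
    (w := fun t => w t - ∫ t in (0 : ℝ)..T, χ t • w t) (hw.sub intervalIntegrable_const)
    fun ψ => by
      obtain ⟨φ, hφ⟩ := exists_testFunction_deriv_eq (ψ - (∫ t in (0 : ℝ)..T, ψ t) • χ) (by
        change ∫ t in (0 : ℝ)..T, (ψ t - (∫ t in (0 : ℝ)..T, ψ t) * χ t) = 0
        rw [intervalIntegral.integral_sub (ψ.continuous.intervalIntegrable _ _)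
          ((χ.continuous.const_mul _).intervalIntegrable _ _),
          intervalIntegral.integral_const_mul, hχ, mul_one, sub_self])
      have h3 := hderiv φ
      rw [hφ] at h3
      have h4 : (∫ t in (0 : ℝ)..T, ψ t • w t)
          - (∫ t in (0 : ℝ)..T, ψ t) • ∫ t in (0 : ℝ)..T, χ t • w t = 0 := by
        rw [← h3, ← intervalIntegral.integral_smul, ← intervalIntegral.integral_sub
          (g := fun t => (∫ t in (0 : ℝ)..T, ψ t) • χ t • w t)
          (hsm _ ψ.continuous _ hw) ((hsm _ χ.continuous _ hw).smul _)]
        refine intervalIntegral.integral_congr fun t _ => ?_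
        change _ = (ψ t - (∫ t in (0 : ℝ)..T, ψ t) * χ t) • w t
        rw [sub_smul, mul_smul]
      simp only [smul_sub]
      rw [intervalIntegral.integral_sub
        (g := fun t => ψ t • ∫ t in (0 : ℝ)..T, χ t • w t) (hsm _ ψ.continuous _ hw)
        ((ψ.continuous.smul continuous_const).intervalIntegrable _ _),
        intervalIntegral.integral_smul_const, h4]
  filter_upwards [key] with t ht
  rw [sub_eq_zero] at ht
  rw [← ht]
  simp [hwdef]

end Primitives

/-- Gronwall's inequality with an integrated right-hand side. -/
theorem le_exp_mul_add_integral {T ω : ℝ} (hω : 0 ≤ ω) {y y' r : ℝ → ℝ}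
    (hy : ContinuousOn y (Set.Icc 0 T)) (hy' : ∀ t ∈ Set.Ioo 0 T, HasDerivAt y (y' t) t)
    (hr : ContinuousOn r (Set.Icc 0 T)) (hr0 : ∀ t, 0 ≤ r t)
    (h : ∀ t ∈ Set.Ioo 0 T, y' t ≤ ω * y t + r t) {t : ℝ} (ht : t ∈ Set.Icc 0 T) :
    y t ≤ Real.exp (ω * t) * (y 0 + ∫ s in (0 : ℝ)..t, r s) := by
  rcases (ht.1.trans ht.2).eq_or_lt with hT | hT
  · obtain rfl : t = 0 := le_antisymm (hT ▸ ht.2) ht.1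
    simp
  have hI : IntervalIntegrable r volume 0 T := by
    refine ContinuousOn.intervalIntegrable ?_
    rwa [Set.uIcc_of_le hT.le]
  have hder : ∀ t ∈ Set.Ioo 0 T, HasDerivAt
      (fun t => Real.exp (-ω * t) * y t - ∫ s in (0 : ℝ)..t, r s)
      (Real.exp (-ω * t) * (-ω) * y t + Real.exp (-ω * t) * y' t - r t) t := fun t ht =>
    ((((hasDerivAt_id t).const_mul (-ω)).exp.congr_deriv (by simp)).mul (hy' t ht)).sub
      (hasDerivAt_integral_of_continuousOn hr ht)
  have hanti : AntitoneOn (fun t => Real.exp (-ω * t) * y t - ∫ s in (0 : ℝ)..t, r s)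
      (Set.Icc 0 T) := by
    refine antitoneOn_of_deriv_nonpos (convex_Icc 0 T) ?_ ?_ ?_
    · exact ((by fun_prop : Continuous fun t : ℝ => Real.exp (-ω * t)).continuousOn.mul hy).sub
        (continuousOn_integral_Icc hT hI)
    · rw [interior_Icc]
      exact fun t ht => (hder t ht).differentiableAt.differentiableWithinAt
    · rw [interior_Icc]
      intro t ht
      rw [(hder t ht).deriv]
      have h1 := h t ht
      -- The weight also multiplies r; since r ≥ 0, it may be replaced by 1.
      have h2 : Real.exp (-ω * t) ≤ 1 := Real.exp_le_one_iff.2 (by nlinarith [ht.1])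
      have h3 := Real.exp_pos (-ω * t)
      have h4 := hr0 t
      nlinarith [mul_le_mul_of_nonneg_left h1 h3.le, mul_le_mul_of_nonneg_right h2 h4]
  have h5 := hanti ⟨le_rfl, hT.le⟩ ht ht.1
  simp only [mul_zero, Real.exp_zero, one_mul, intervalIntegral.integral_same, sub_zero] at h5
  have h6 : Real.exp (ω * t) * Real.exp (-ω * t) = 1 := by
    rw [← Real.exp_add]; simp
  calc y t = Real.exp (ω * t) * (Real.exp (-ω * t) * y t) := by rw [← mul_assoc, h6, one_mul]
    _ ≤ _ := mul_le_mul_of_nonneg_left (by linarith) (Real.exp_pos _).le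

/-! ### Skew-adjoint relations and energy estimates -/

section SkewAdjoint

set_option linter.unusedSectionVars false

variable {Z : Type*} [NormedAddCommGroup Z] [InnerProductSpace ℝ Z]

/-- `Γ` is the graph of a skew-adjoint linear relation. -/
def IsSkewAdjointRel (Γ : Submodule ℝ (Z × Z)) : Prop :=
  ∀ y w : Z, (y, w) ∈ Γ ↔ ∀ a b : Z, (a, b) ∈ Γ → ⟪b, y⟫_ℝ + ⟪a, w⟫_ℝ = 0

/-- The pair is tested against itself. This cancellation removes the unbounded part from every
energy balance. -/
theorem IsSkewAdjointRel.inner_eq_zero {Γ : Submodule ℝ (Z × Z)} (hΓ : IsSkewAdjointRel Γ)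
    {a b : Z} (h : (a, b) ∈ Γ) : ⟪a, b⟫_ℝ = 0 := by
  have h1 := (hΓ a b).1 h a b h
  rw [real_inner_comm] at h1
  linarith

/-- Expresses a double backward integral through a continuous weight, which is therefore admissible
as the derivative of a C¹ test function. -/
theorem integral_max_sub_smul {X : Type*} [NormedAddCommGroup X] [NormedSpace ℝ X]
    [CompleteSpace X] {T t : ℝ} (ht : t ∈ Set.Icc 0 T) {G : ℝ → X}
    (hG : ∀ a b, IntervalIntegrable G volume a b) :
    ∫ r in (0 : ℝ)..T, max (r - t) 0 • G r = ∫ r in t..T, ∫ s in r..T, G s := by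
  have hi : ∀ a b, IntervalIntegrable (fun r => max (r - t) 0 • G r) volume a b := fun a b =>
    (hG a b).continuousOn_smul (by fun_prop : Continuous fun r : ℝ => max (r - t) 0).continuousOn
  have h1 : ∫ r in (0 : ℝ)..t, max (r - t) 0 • G r = 0 := by
    refine (intervalIntegral.integral_congr (g := fun _ => (0 : X)) fun r hr => ?_).trans
      intervalIntegral.integral_zero
    rw [Set.uIcc_of_le ht.1] at hr
    simp [max_eq_right (sub_nonpos.2 hr.2)]
  have h2 : ∫ r in t..T, max (r - t) 0 • G r = ∫ r in t..T, (r - t) • G r := by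
    refine intervalIntegral.integral_congr fun r hr => ?_
    rw [Set.uIcc_of_le ht.2] at hr
    simp [max_eq_left (sub_nonneg.2 hr.1)]
  rw [← intervalIntegral.integral_add_adjacent_intervals (hi 0 t) (hi t T), h1, h2, zero_add,
    integral_smul_eq_add_integral_smul_integral ht.2 (φ := fun r => r - t) (φ' := fun _ => 1)
      (fun r => (hasDerivAt_id r).sub_const t) continuous_const (hG t T)]
  simp

theorem hasDerivAt_integral_left {X : Type*} [NormedAddCommGroup X] [NormedSpace ℝ X]
    [CompleteSpace X] {G : ℝ → X} (hG : Continuous G) (t T : ℝ) :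
    HasDerivAt (fun r => ∫ s in r..T, G s) (-G t) t :=
  intervalIntegral.integral_hasDerivAt_left (hG.intervalIntegrable _ _)
    (hG.stronglyMeasurableAtFilter _ _) hG.continuousAt

variable [CompleteSpace Z]

/-- A weak solution of the homogeneous adjoint backward problem vanishes. -/
theorem IsSkewAdjointRel.ae_eq_zero_of_weak_adjoint {Γ : Submodule ℝ (Z × Z)}
    (hΓ : IsSkewAdjointRel Γ) (L : Z →L[ℝ] Z) {T : ℝ} (hT : 0 < T) {Y : ℝ → Z}
    (hY : Integrable Y)
    (h : ∀ z s : Z, (z, s) ∈ Γ → ∀ φ φ' : ℝ → ℝ, (∀ t, HasDerivAt φ (φ' t) t) → Continuous φ' →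
      φ 0 = 0 → ⟪z, ∫ t in (0 : ℝ)..T, φ' t • Y t⟫_ℝ + ⟪s + L z, ∫ t in (0 : ℝ)..T, φ t • Y t⟫_ℝ
        = 0) :
    ∀ᵐ t ∂volume.restrict (Set.Ioo 0 T), Y t = 0 := by
  have hYi : ∀ a b, IntervalIntegrable Y volume a b := fun a b => hY.intervalIntegrable
  -- Y is merely integrable, so the energy argument is applied to its third backward primitive V₂,
  -- which is C² and vanishes at T.
  let W : ℝ → Z := fun r => ∫ s in r..T, Y s
  let V₁ : ℝ → Z := fun r => ∫ s in r..T, W s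
  let V₂ : ℝ → Z := fun r => ∫ s in r..T, V₁ s
  have hW : Continuous W := by
    have h1 := (intervalIntegral.continuous_primitive hYi T).neg
    refine h1.congr fun t => ?_
    exact (intervalIntegral.integral_symm T t).symm
  have hV₁' : ∀ t, HasDerivAt V₁ (-W t) t := fun t => hasDerivAt_integral_left hW t T
  have hV₁ : Continuous V₁ := continuous_iff_continuousAt.2 fun t => (hV₁' t).continuousAt
  have hV₂' : ∀ t, HasDerivAt V₂ (-V₁ t) t := fun t => hasDerivAt_integral_left hV₁ t T
  have hV₂ : Continuous V₂ := continuous_iff_continuousAt.2 fun t => (hV₂' t).continuousAt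
  -- Choosing φ' = max(r - t, 0) turns the hypothesis into a pointwise identity for V₁ t and V₂ t;
  -- self-duality of Γ then gives membership.
  have hrel : ∀ t ∈ Set.Icc 0 T, (V₂ t, V₁ t + L.adjoint (V₂ t)) ∈ Γ := by
    intro t ht
    refine (hΓ _ _).2 fun z s hzs => ?_
    have hφ' : Continuous fun r : ℝ => max (r - t) 0 := by fun_prop
    have hφ : ∀ r, HasDerivAt (fun r => ∫ s in (0 : ℝ)..r, max (s - t) 0) (max (r - t) 0) r :=
      fun r => intervalIntegral.integral_hasDerivAt_right (hφ'.intervalIntegrable _ _)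
        (hφ'.stronglyMeasurableAtFilter _ _) hφ'.continuousAt
    have h1 := h z s hzs _ _ hφ hφ' intervalIntegral.integral_same
    rw [integral_smul_eq_add_integral_smul_integral hT.le hφ hφ' (hYi 0 T),
      intervalIntegral.integral_same, zero_smul, zero_add, integral_max_sub_smul ht hYi,
      integral_max_sub_smul ht fun a b => hW.intervalIntegrable a b] at h1
    change ⟪z, V₁ t⟫_ℝ + ⟪s + L z, V₂ t⟫_ℝ = 0 at h1
    rw [inner_add_right, ContinuousLinearMap.adjoint_inner_right, ← h1, inner_add_left]
    ring
  -- Gronwall in reversed time τ = T - t. As V₁ + L* V₂ is orthogonal to V₂, only the bounded L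
  -- contributes to the growth.
  have hzero : ∀ t ∈ Set.Icc 0 T, V₂ t = 0 := by
    have hder : ∀ τ, HasDerivAt (fun τ => ‖V₂ (T - τ)‖ ^ 2) (2 * ⟪V₂ (T - τ), V₁ (T - τ)⟫_ℝ) τ := by
      intro τ
      have h1 : HasDerivAt (fun τ => V₂ (T - τ)) (V₁ (T - τ)) τ := by
        have := (hV₂' (T - τ)).scomp τ ((hasDerivAt_id τ).const_sub T)
        simpa [Function.comp_def] using this
      exact h1.norm_sq
    intro t ht
    have hgr := le_exp_mul_add_integral (T := T) (ω := 2 * ‖L‖) (by positivity)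
      (y := fun τ => ‖V₂ (T - τ)‖ ^ 2) (r := fun _ => 0)
      (continuous_iff_continuousAt.2 fun τ => (hder τ).continuousAt).continuousOn
      (fun τ _ => hder τ) continuousOn_const (fun _ => le_rfl) (fun τ hτ => ?_)
      (t := T - t) ⟨by linarith [ht.2], by linarith [ht.1]⟩
    · have h0 : V₂ T = 0 := intervalIntegral.integral_same
      simp only [sub_sub_cancel, sub_zero, h0] at hgr
      have : ‖V₂ t‖ ^ 2 ≤ 0 := by simpa using hgr
      simpa using pow_eq_zero_iff (two_ne_zero) |>.1 (le_antisymm this (sq_nonneg _))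
    · have h1 := hΓ.inner_eq_zero (hrel (T - τ) ⟨by linarith [hτ.2], by linarith [hτ.1]⟩)
      rw [inner_add_right, ContinuousLinearMap.adjoint_inner_right] at h1
      have h2 : -⟪L (V₂ (T - τ)), V₂ (T - τ)⟫_ℝ ≤ ‖L‖ * ‖V₂ (T - τ)‖ * ‖V₂ (T - τ)‖ :=
        (neg_le_abs _).trans ((abs_real_inner_le_norm _ _).trans
          (mul_le_mul_of_nonneg_right (L.le_opNorm _) (norm_nonneg _)))
      change 2 * ⟪V₂ (T - τ), V₁ (T - τ)⟫_ℝ ≤ 2 * ‖L‖ * ‖V₂ (T - τ)‖ ^ 2 + 0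
      nlinarith
  have hderiv0 : ∀ V V' : ℝ → Z, (∀ t, HasDerivAt V (-V' t) t) → (∀ t ∈ Set.Ioo 0 T, V t = 0) →
      ∀ t ∈ Set.Ioo 0 T, V' t = 0 := by
    intro V V' hV h0 t ht
    have h1 : V =ᶠ[nhds t] fun _ => 0 :=
      Filter.eventually_of_mem (isOpen_Ioo.mem_nhds ht) h0
    have h2 := (hV t).unique ((hasDerivAt_const t (0 : Z)).congr_of_eventuallyEq h1)
    simpa using h2
  have hW0 : ∀ t ∈ Set.Ioo 0 T, W t = 0 :=
    hderiv0 V₁ W hV₁' (hderiv0 V₂ V₁ hV₂' fun t ht => hzero t ⟨ht.1.le, ht.2.le⟩)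
  refine ae_eq_zero_of_integral_testFunction_smul hT (hYi 0 T) fun φ => ?_
  rw [integral_smul_eq_add_integral_smul_integral hT.le (testFunction_hasDerivAt φ)
    (testFunction_continuous_deriv φ) (hYi 0 T),
    testFunction_eq_zero φ (by simp : (0 : ℝ) ∉ Set.Ioo 0 T), zero_smul, zero_add,
    intervalIntegral.integral_of_le hT.le, ← restrict_Ioo_eq_restrict_Ioc]
  refine setIntegral_eq_zero_of_forall_eq_zero fun t ht => ?_
  rw [show ∫ s in t..T, Y s = 0 from hW0 t ht, smul_zero]

/-- `x` is a classical solution of `x' + s + L x = u` with `(x, s)` in the relation `Γ`. -/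
structure IsClassical (Γ : Submodule ℝ (Z × Z)) (L : Z →L[ℝ] Z) (x x' s : ℝ → Z) : Prop where
  hasDerivAt : ∀ t, HasDerivAt x (x' t) t
  continuous_deriv : Continuous x'
  continuous_rel : Continuous s
  mem : ∀ t, (x t, s t) ∈ Γ

namespace IsClassical

variable {Γ : Submodule ℝ (Z × Z)} {L : Z →L[ℝ] Z} {x x' s y y' r : ℝ → Z}

theorem continuous (h : IsClassical Γ L x x' s) : Continuous x :=
  continuous_iff_continuousAt.2 fun t => (h.hasDerivAt t).continuousAt

theorem continuous_rhs (h : IsClassical Γ L x x' s) : Continuous fun t => x' t + s t + L (x t) :=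
  (h.continuous_deriv.add h.continuous_rel).add (L.continuous.comp h.continuous)

theorem add (h : IsClassical Γ L x x' s) (h' : IsClassical Γ L y y' r) :
    IsClassical Γ L (fun t => x t + y t) (fun t => x' t + y' t) (fun t => s t + r t) where
  hasDerivAt t := (h.hasDerivAt t).add (h'.hasDerivAt t)
  continuous_deriv := h.continuous_deriv.add h'.continuous_deriv
  continuous_rel := h.continuous_rel.add h'.continuous_rel
  mem t := Γ.add_mem (h.mem t) (h'.mem t)

theorem const_smul (c : ℝ) (h : IsClassical Γ L x x' s) :
    IsClassical Γ L (fun t => c • x t) (fun t => c • x' t) (fun t => c • s t) where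
  hasDerivAt t := (h.hasDerivAt t).const_smul c
  continuous_deriv := h.continuous_deriv.const_smul c
  continuous_rel := h.continuous_rel.const_smul c
  mem t := Γ.smul_mem c (h.mem t)

theorem sub (h : IsClassical Γ L x x' s) (h' : IsClassical Γ L y y' r) :
    IsClassical Γ L (fun t => x t - y t) (fun t => x' t - y' t) (fun t => s t - r t) := by
  simpa [sub_eq_add_neg] using h.add (h'.const_smul (-1))

/-- The energy estimate. -/
theorem norm_sq_le (hΓ : IsSkewAdjointRel Γ) (h : IsClassical Γ L x x' s) {T t : ℝ}
    (ht : t ∈ Set.Icc 0 T) :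
    ‖x t‖ ^ 2 ≤ Real.exp ((1 + 2 * ‖L‖) * T)
      * (‖x 0‖ ^ 2 + ∫ t in (0 : ℝ)..T, ‖x' t + s t + L (x t)‖ ^ 2) := by
  have hc : Continuous fun t => ‖x' t + s t + L (x t)‖ ^ 2 := h.continuous_rhs.norm.pow 2
  -- The 1 comes from Young's inequality for the product of x with the right-hand side, and 2‖L‖
  -- from the term with L.
  have hgr := le_exp_mul_add_integral (T := T) (ω := 1 + 2 * ‖L‖) (by positivity)
    (y := fun t => ‖x t‖ ^ 2) (r := fun t => ‖x' t + s t + L (x t)‖ ^ 2)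
    (h.continuous.norm.pow 2).continuousOn (fun t _ => (h.hasDerivAt t).norm_sq)
    hc.continuousOn (fun t => sq_nonneg _) (fun t _ => ?_) ht
  · refine hgr.trans ?_
    have h1 : ∫ t in (0 : ℝ)..t, ‖x' t + s t + L (x t)‖ ^ 2
        ≤ ∫ t in (0 : ℝ)..T, ‖x' t + s t + L (x t)‖ ^ 2 :=
      intervalIntegral.integral_mono_interval le_rfl ht.1 ht.2 (ae_of_all _ fun t => sq_nonneg _)
        (hc.intervalIntegrable _ _)
    have h2 : 0 ≤ ∫ t in (0 : ℝ)..t, ‖x' t + s t + L (x t)‖ ^ 2 :=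
      intervalIntegral.integral_nonneg ht.1 fun t _ => sq_nonneg _
    exact mul_le_mul (Real.exp_le_exp.2 (mul_le_mul_of_nonneg_left ht.2 (by positivity)))
      (by linarith) (by positivity) (Real.exp_pos _).le
  · have h0 := hΓ.inner_eq_zero (h.mem t)
    have h3 : ⟪x t, x' t⟫_ℝ = ⟪x t, x' t + s t + L (x t)⟫_ℝ - ⟪x t, L (x t)⟫_ℝ := by
      rw [inner_add_right, inner_add_right, h0]; ring
    have h4 := real_inner_le_norm (x t) (x' t + s t + L (x t))
    have h5 : -⟪x t, L (x t)⟫_ℝ ≤ ‖x t‖ * (‖L‖ * ‖x t‖) :=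
      (neg_le_abs _).trans ((abs_real_inner_le_norm _ _).trans
          (mul_le_mul_of_nonneg_left (L.le_opNorm _) (norm_nonneg _)))
    rw [h3]
    nlinarith [sq_nonneg (‖x t‖ - ‖x' t + s t + L (x t)‖)]

/-- The second entry equals ∫ s, and Γ is cut out by continuous linear conditions, so it contains
integrals of its continuous curves. In this form x' and s occur only within the right-hand side, so
it survives limits of the data. -/
theorem integral_mem (hΓ : IsSkewAdjointRel Γ) (h : IsClassical Γ L x x' s) (t : ℝ) :
    (∫ r in (0 : ℝ)..t, x r, x 0 + (∫ r in (0 : ℝ)..t, (x' r + s r + L (x r))) - x t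
      - L (∫ r in (0 : ℝ)..t, x r)) ∈ Γ := by
  have hx := h.continuous.intervalIntegrable (μ := volume) 0 t
  have hx' := h.continuous_deriv.intervalIntegrable (μ := volume) 0 t
  have hs := h.continuous_rel.intervalIntegrable (μ := volume) 0 t
  have hL : IntervalIntegrable (fun r => L (x r)) volume 0 t :=
    (L.continuous.comp h.continuous).intervalIntegrable (μ := volume) 0 t
  have h1 : x 0 + (∫ r in (0 : ℝ)..t, (x' r + s r + L (x r))) - x t
      - L (∫ r in (0 : ℝ)..t, x r) = ∫ r in (0 : ℝ)..t, s r := by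
    rw [intervalIntegral.integral_add (hx'.add hs) hL, intervalIntegral.integral_add hx' hs,
      intervalIntegral.integral_eq_sub_of_hasDerivAt (fun t _ => h.hasDerivAt t) hx',
      L.intervalIntegral_comp_comm hx]
    abel
  rw [h1]
  refine (hΓ _ _).2 fun a b hab => ?_
  have e1 : ⟪b, ∫ r in (0 : ℝ)..t, x r⟫_ℝ = ∫ r in (0 : ℝ)..t, ⟪b, x r⟫_ℝ :=
    ((innerSL ℝ b).intervalIntegral_comp_comm hx).symm
  have e2 : ⟪a, ∫ r in (0 : ℝ)..t, s r⟫_ℝ = ∫ r in (0 : ℝ)..t, ⟪a, s r⟫_ℝ :=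
    ((innerSL ℝ a).intervalIntegral_comp_comm hs).symm
  rw [e1, e2, ← intervalIntegral.integral_add
    ((continuous_const.inner h.continuous).intervalIntegrable _ _)
    ((continuous_const.inner h.continuous_rel).intervalIntegrable _ _)]
  simp [(hΓ _ _).1 (h.mem _) a b hab]

end IsClassical

end SkewAdjoint

/-! ### Integrated solutions as limits of classical ones -/

section Existence

variable {Z : Type*} [NormedAddCommGroup Z] [InnerProductSpace ℝ Z] [CompleteSpace Z]

/-- Initial value and right-hand side of the classical solutions on `(0, T)`. -/
def classicalData (Γ : Submodule ℝ (Z × Z)) (L : Z →L[ℝ] Z) (T : ℝ) :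
    Submodule ℝ (WithLp 2 (Z × Lp Z 2 (volume.restrict (Set.Ioc 0 T)))) where
  carrier := {d | ∃ x x' s, IsClassical Γ L x x' s ∧ x 0 = d.fst ∧
    d.snd =ᵐ[volume.restrict (Set.Ioc 0 T)] fun t => x' t + s t + L (x t)}
  zero_mem' := ⟨fun _ => 0, fun _ => 0, fun _ => 0,
    ⟨fun t => hasDerivAt_const t 0, continuous_const, continuous_const, fun _ => Γ.zero_mem⟩, rfl,
    by
      filter_upwards [Lp.coeFn_zero Z 2 (volume.restrict (Set.Ioc 0 T))] with t ht
      rw [WithLp.zero_snd, ht]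
      simp⟩
  add_mem' := by
    rintro d e ⟨x, x', s, h, h0, h1⟩ ⟨y, y', r, k, k0, k1⟩
    refine ⟨_, _, _, h.add k, by rw [h0, k0]; rfl, ?_⟩
    filter_upwards [Lp.coeFn_add d.snd e.snd, h1, k1] with t ht h2 k2
    rw [WithLp.add_snd, ht, Pi.add_apply, h2, k2, map_add]
    abel
  smul_mem' := by
    rintro c d ⟨x, x', s, h, h0, h1⟩
    refine ⟨_, _, _, h.const_smul c, by rw [h0]; rfl, ?_⟩
    filter_upwards [Lp.coeFn_smul c d.snd, h1] with t ht h2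
    rw [WithLp.smul_snd, ht, Pi.smul_apply, h2, map_smul, smul_add, smul_add]

theorem IsClassical.norm_le_of_data {Γ : Submodule ℝ (Z × Z)} {L : Z →L[ℝ] Z} {x x' s : ℝ → Z}
    (hΓ : IsSkewAdjointRel Γ) (h : IsClassical Γ L x x' s) {T t : ℝ} (ht : t ∈ Set.Icc 0 T)
    {d : WithLp 2 (Z × Lp Z 2 (volume.restrict (Set.Ioc 0 T)))} (h0 : x 0 = d.fst)
    (hd : d.snd =ᵐ[volume.restrict (Set.Ioc 0 T)] fun t => x' t + s t + L (x t)) :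
    ‖x t‖ ≤ Real.sqrt (Real.exp ((1 + 2 * ‖L‖) * T)) * ‖d‖ := by
  have h1 : ‖d‖ ^ 2 = ‖x 0‖ ^ 2 + ∫ t in (0 : ℝ)..T, ‖x' t + s t + L (x t)‖ ^ 2 := by
    rw [WithLp.prod_norm_sq_eq_of_L2, h0, ← real_inner_self_eq_norm_sq d.snd, L2.inner_def,
      intervalIntegral.integral_of_le (ht.1.trans ht.2)]
    congr 1
    refine integral_congr_ae ?_
    filter_upwards [hd] with t ht
    rw [ht, real_inner_self_eq_norm_sq]
  have h2 := h.norm_sq_le hΓ ht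
  rw [← h1] at h2
  refine abs_le_of_sq_le_sq' ?_ (by positivity) |>.2
  rwa [mul_pow, Real.sq_sqrt (Real.exp_pos _).le]

/-- Tested time integrals are continuous functionals on L², so they pass to the limit with the data.
-/
theorem inner_integral_Lp {T t : ℝ} (ht : t ∈ Set.Icc 0 T) (a : Z)
    (F : Lp Z 2 (volume.restrict (Set.Ioc 0 T))) :
    ⟪indicatorConstLp 2 (measurableSet_Ioc (a := (0 : ℝ)) (b := t)) (measure_ne_top _ _) a, F⟫_ℝ
      = ⟪a, ∫ s in (0 : ℝ)..t, F s⟫_ℝ := by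
  rw [L2.inner_indicatorConstLp_eq_inner_setIntegral, Measure.restrict_restrict measurableSet_Ioc,
    intervalIntegral.integral_of_le ht.1,
    Set.inter_eq_left.2 (Set.Ioc_subset_Ioc_right ht.2)]

/-- The data of classical solutions are dense, up to the multivalued part of `Γ`. -/
theorem mem_closure_classicalData {Γ : Submodule ℝ (Z × Z)} (hΓ : IsSkewAdjointRel Γ)
    (L : Z →L[ℝ] Z) {T : ℝ} (hT : 0 < T)
    (d : WithLp 2 (Z × Lp Z 2 (volume.restrict (Set.Ioc 0 T))))
    (hd : ∀ w : Z, (0, w) ∈ Γ → ⟪w, d.fst⟫_ℝ = 0) :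
    d ∈ closure (classicalData Γ L T : Set (WithLp 2 (Z × Lp Z 2 (volume.restrict (Set.Ioc 0 T)))))
    := by
  rw [← Submodule.topologicalClosure_coe, SetLike.mem_coe,
    ← Submodule.orthogonal_orthogonal_eq_closure, Submodule.mem_orthogonal]
  intro e he
  rw [Submodule.mem_orthogonal] at he
  have hYint : IntegrableOn e.snd (Set.Ioc 0 T) := (Lp.memLp e.snd).integrable one_le_two
  have hY : IntervalIntegrable e.snd volume 0 T :=
    (intervalIntegrable_iff_integrableOn_Ioc_of_le hT.le).2 hYint
  -- Separated functions φ(t) z with z in the domain of Γ are classical solutions; this is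
  -- orthogonality to their data.
  have key : ∀ z s : Z, (z, s) ∈ Γ → ∀ φ φ' : ℝ → ℝ, (∀ t, HasDerivAt φ (φ' t) t) →
      Continuous φ' → φ 0 * ⟪z, e.fst⟫_ℝ + (⟪z, ∫ t in (0 : ℝ)..T, φ' t • e.snd t⟫_ℝ
        + ⟪s + L z, ∫ t in (0 : ℝ)..T, φ t • e.snd t⟫_ℝ) = 0 := by
    intro z s hzs φ φ' hφ hφ'
    have hφc : Continuous φ := continuous_iff_continuousAt.2 fun t => (hφ t).continuousAt
    have hcl : IsClassical Γ L (fun t => φ t • z) (fun t => φ' t • z) (fun t => φ t • s) :=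
      ⟨fun t => (hφ t).smul_const z, hφ'.smul continuous_const, hφc.smul continuous_const,
        fun t => Γ.smul_mem (φ t) hzs⟩
    have hmem : MemLp (fun t => φ' t • z + φ t • s + L (φ t • z)) 2
        (volume.restrict (Set.Ioc 0 T)) := by
      rw [← restrict_Ioo_eq_restrict_Ioc]
      exact memL2_of_continuousOn hcl.continuous_rhs.continuousOn
    have h1 := he (WithLp.toLp 2 (φ 0 • z, hmem.toLp _))
      ⟨_, _, _, hcl, rfl, hmem.coeFn_toLp⟩
    rw [WithLp.prod_inner_apply, L2.inner_def] at h1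
    have hφY := hY.continuousOn_smul hφc.continuousOn
    have hφY' := hY.continuousOn_smul hφ'.continuousOn
    have e1 : ⟪z, ∫ t in (0 : ℝ)..T, φ' t • e.snd t⟫_ℝ
        = ∫ t in (0 : ℝ)..T, ⟪z, φ' t • e.snd t⟫_ℝ :=
      ((innerSL ℝ z).intervalIntegral_comp_comm hφY').symm
    have e2 : ⟪s + L z, ∫ t in (0 : ℝ)..T, φ t • e.snd t⟫_ℝ
        = ∫ t in (0 : ℝ)..T, ⟪s + L z, φ t • e.snd t⟫_ℝ :=
      ((innerSL ℝ (s + L z)).intervalIntegral_comp_comm hφY).symm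
    have e3 := intervalIntegral.integral_add
      (f := fun t => ⟪z, φ' t • e.snd t⟫_ℝ) (g := fun t => ⟪s + L z, φ t • e.snd t⟫_ℝ)
      ⟨(innerSL ℝ z).integrable_comp hφY'.1, (innerSL ℝ z).integrable_comp hφY'.2⟩
      ⟨(innerSL ℝ (s + L z)).integrable_comp hφY.1,
        (innerSL ℝ (s + L z)).integrable_comp hφY.2⟩
    rw [e1, e2, ← e3]
    refine Eq.trans ?_ h1
    congr 1
    · exact (real_inner_smul_left _ _ _).symm
    · rw [intervalIntegral.integral_of_le hT.le]
      refine integral_congr_ae ?_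
      filter_upwards [hmem.coeFn_toLp] with t ht
      change _ = ⟪hmem.toLp _ t, e.snd t⟫_ℝ
      rw [ht, map_smul]
      simp only [inner_add_left, real_inner_smul_left, real_inner_smul_right]
      ring
  have hind : ∀ φ : ℝ → ℝ, ∫ t in (0 : ℝ)..T, φ t • (Set.Ioc 0 T).indicator e.snd t
      = ∫ t in (0 : ℝ)..T, φ t • e.snd t := by
    intro φ
    rw [intervalIntegral.integral_of_le hT.le, intervalIntegral.integral_of_le hT.le]
    refine setIntegral_congr_fun measurableSet_Ioc fun t ht => ?_
    simp only [Set.indicator_of_mem ht]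
  -- Taking φ 0 = 0 removes the initial value and leaves the weak adjoint problem. The indicator
  -- makes the function integrable on the whole line.
  have hY0 := hΓ.ae_eq_zero_of_weak_adjoint L hT (Y := (Set.Ioc 0 T).indicator e.snd)
    (hYint.integrable_indicator measurableSet_Ioc) (by
      intro z s hzs φ φ' hφ hφ' h0
      have h1 := key z s hzs φ φ' hφ hφ'
      rwa [h0, zero_mul, zero_add, ← hind φ, ← hind φ'] at h1)
  have hY0' : e.snd = 0 := by
    refine Lp.ext ?_
    rw [restrict_Ioo_eq_restrict_Ioc] at hY0
    filter_upwards [hY0, ae_restrict_mem measurableSet_Ioc,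
      Lp.coeFn_zero Z 2 (volume.restrict (Set.Ioc 0 T))] with t ht htm h0
    rw [Set.indicator_of_mem htm] at ht
    rw [ht, h0, Pi.zero_apply]
  have hint0 : ∀ φ : ℝ → ℝ, ∫ t in (0 : ℝ)..T, φ t • e.snd t = 0 := by
    intro φ
    rw [intervalIntegral.integral_of_le hT.le, hY0']
    refine integral_eq_zero_of_ae ?_
    filter_upwards [Lp.coeFn_zero Z 2 (volume.restrict (Set.Ioc 0 T))] with t ht
    rw [ht, Pi.zero_apply, smul_zero]
  -- With the source part gone, φ = 1 shows that `e.fst` is orthogonal to the domain of Γ, hence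
  -- multivalued.
  have hmul : (0, e.fst) ∈ Γ := by
    refine (hΓ _ _).2 fun z s hzs => ?_
    have h1 := key z s hzs (fun _ => 1) (fun _ => 0) (fun t => hasDerivAt_const t 1)
      continuous_const
    rw [hint0, hint0] at h1
    simpa using h1
  rw [WithLp.prod_inner_apply]
  change ⟪e.fst, d.fst⟫_ℝ + ⟪e.snd, d.snd⟫_ℝ = 0
  rw [hd _ hmul, hY0', inner_zero_left, add_zero]

/-- Integrated solutions of `x' + S x + L x = F`, with `S` a skew-adjoint relation and `L`
bounded. -/
theorem IsSkewAdjointRel.exists_mild {Γ : Submodule ℝ (Z × Z)} (hΓ : IsSkewAdjointRel Γ)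
    (L : Z →L[ℝ] Z) {T : ℝ} (hT : 0 < T) {F : ℝ → Z} (hF : MemL2 T F) (x₀ : Z)
    (hx₀ : ∀ w : Z, (0, w) ∈ Γ → ⟪w, x₀⟫_ℝ = 0) :
    ∃ x : ℝ → Z, ContinuousOn x (Set.Icc 0 T) ∧ x 0 = x₀ ∧ ∀ t ∈ Set.Icc 0 T,
      (∫ r in (0 : ℝ)..t, x r, x₀ + (∫ r in (0 : ℝ)..t, F r) - x t
        - L (∫ r in (0 : ℝ)..t, x r)) ∈ Γ := by
  have hF' : MemLp F 2 (volume.restrict (Set.Ioc 0 T)) := by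
    rwa [← restrict_Ioo_eq_restrict_Ioc]
  obtain ⟨d, hd, hdlim⟩ := mem_closure_iff_seq_limit.1 (mem_closure_classicalData hΓ L hT
    (WithLp.toLp 2 (x₀, hF'.toLp F)) hx₀)
  choose x x' s hcl h0 hrhs using hd
  set C := Real.sqrt (Real.exp ((1 + 2 * ‖L‖) * T)) with hC
  have hdiff : ∀ m n, ∀ t ∈ Set.Icc 0 T, ‖x m t - x n t‖ ≤ C * ‖d m - d n‖ := by
    intro m n t ht
    refine ((hcl m).sub (hcl n)).norm_le_of_data hΓ ht (d := d m - d n) ?_ ?_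
    · rw [h0, h0]; rfl
    · filter_upwards [Lp.coeFn_sub (d m).snd (d n).snd, hrhs m, hrhs n] with t ht hm hn
      rw [WithLp.sub_snd, ht, Pi.sub_apply, hm, hn, map_sub]
      abel
  have hcauchy : UniformCauchySeqOn x Filter.atTop (Set.Icc 0 T) := by
    rw [Metric.uniformCauchySeqOn_iff]
    intro ε hε
    obtain ⟨N, hN⟩ := Metric.cauchySeq_iff.1 hdlim.cauchySeq (ε / (C + 1)) (by positivity)
    refine ⟨N, fun m hm n hn t ht => ?_⟩
    have h1 := hN m hm n hn
    rw [dist_eq_norm] at h1 ⊢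
    have hC0 : 0 ≤ C := Real.sqrt_nonneg _
    calc ‖x m t - x n t‖ ≤ C * ‖d m - d n‖ := hdiff m n t ht
      _ ≤ (C + 1) * ‖d m - d n‖ := by gcongr; linarith
      _ < (C + 1) * (ε / (C + 1)) := by gcongr
      _ = ε := by field_simp
  have hpt : ∀ t ∈ Set.Icc 0 T, ∃ y, Filter.Tendsto (fun n => x n t) Filter.atTop (nhds y) :=
    fun t ht => cauchySeq_tendsto_of_complete (hcauchy.cauchySeq ht)
  choose! y hy using hpt
  have hunif : TendstoUniformlyOn x y Filter.atTop (Set.Icc 0 T) :=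
    hcauchy.tendstoUniformlyOn_of_tendsto hy
  have hyc : ContinuousOn y (Set.Icc 0 T) :=
    hunif.continuousOn (Filter.Frequently.of_forall fun n => (hcl n).continuous.continuousOn)
  have hd0 : Filter.Tendsto (fun n => x n 0) Filter.atTop (nhds x₀) := by
    have h1 : Filter.Tendsto (fun n => (d n).fst) Filter.atTop
        (nhds (WithLp.toLp 2 (x₀, hF'.toLp F)).fst) :=
      ((WithLp.prod_continuous_ofLp 2 _ _).fst.tendsto _).comp hdlim
    simp only [h0]
    exact h1
  refine ⟨y, hyc, tendsto_nhds_unique (hy 0 ⟨le_rfl, hT.le⟩) hd0, fun t ht => ?_⟩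
  have hIcc : Set.uIcc 0 t ⊆ Set.Icc 0 T := by
    rw [Set.uIcc_of_le ht.1]
    exact Set.Icc_subset_Icc_right ht.2
  have hint : Filter.Tendsto (fun n => ∫ r in (0 : ℝ)..t, x n r) Filter.atTop
      (nhds (∫ r in (0 : ℝ)..t, y r)) :=
    TendstoUniformlyOn.tendsto_intervalIntegral_of_continuousOn
      (Filter.Eventually.of_forall fun n => (hcl n).continuous.continuousOn) (hunif.mono hIcc)
  have hdata : ∀ a : Z, Filter.Tendsto
      (fun n => ⟪a, ∫ r in (0 : ℝ)..t, (x' n r + s n r + L (x n r))⟫_ℝ) Filter.atTop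
      (nhds ⟪a, ∫ r in (0 : ℝ)..t, F r⟫_ℝ) := by
    intro a
    have h1 : Filter.Tendsto (fun n => (d n).snd) Filter.atTop
        (nhds (WithLp.toLp 2 (x₀, hF'.toLp F)).snd) :=
      ((WithLp.prod_continuous_ofLp 2 _ _).snd.tendsto _).comp hdlim
    have h2 := (tendsto_const_nhds (x := indicatorConstLp 2
      (measurableSet_Ioc (a := (0 : ℝ)) (b := t)) (measure_ne_top _ _) a)).inner (𝕜 := ℝ) h1
    simp only [inner_integral_Lp ht] at h2
    have hae : ∀ {u v : ℝ → Z}, u =ᵐ[volume.restrict (Set.Ioc 0 T)] v →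
        ∫ r in (0 : ℝ)..t, u r = ∫ r in (0 : ℝ)..t, v r := by
      intro u v huv
      rw [intervalIntegral.integral_of_le ht.1, intervalIntegral.integral_of_le ht.1]
      exact integral_congr_ae (ae_restrict_of_ae_restrict_of_subset
        (Set.Ioc_subset_Ioc_right ht.2) huv)
    simp only [fun n => hae (hrhs n)] at h2
    convert h2 using 3
    exact hae hF'.coeFn_toLp.symm
  -- Γ is its own dual, so it suffices to pass to the limit after testing with a pair of Γ.
  refine (hΓ _ _).2 fun a b hab => ?_
  have hlim : Filter.Tendsto (fun n => ⟪b, ∫ r in (0 : ℝ)..t, x n r⟫_ℝ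
      + ⟪a, x n 0 + (∫ r in (0 : ℝ)..t, (x' n r + s n r + L (x n r))) - x n t
      - L (∫ r in (0 : ℝ)..t, x n r)⟫_ℝ) Filter.atTop (nhds (⟪b, ∫ r in (0 : ℝ)..t, y r⟫_ℝ
      + ⟪a, x₀ + (∫ r in (0 : ℝ)..t, F r) - y t - L (∫ r in (0 : ℝ)..t, y r)⟫_ℝ)) := by
    simp only [inner_sub_right, inner_add_right]
    exact (tendsto_const_nhds.inner hint).add ((((tendsto_const_nhds.inner hd0).add
      (hdata a)).sub (tendsto_const_nhds.inner (hy t ht))).sub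
      (tendsto_const_nhds.inner ((L.continuous.tendsto _).comp hint)))
  refine tendsto_nhds_unique hlim ?_
  simp only [fun n => (hΓ _ _).1 ((hcl n).integral_mem hΓ t) a b hab]
  exact tendsto_const_nhds

end Existence

/-! ### Inverses from lower bounds and from inf-sup stability -/

section Operators

set_option linter.unusedSectionVars false

variable {E F : Type*} [NormedAddCommGroup E] [InnerProductSpace ℝ E] [CompleteSpace E]
  [NormedAddCommGroup F] [InnerProductSpace ℝ F] [CompleteSpace F]

/-- The Riesz isomorphism of a real Hilbert space, as a linear map. -/
noncomputable def riesz : StrongDual ℝ E →L[ℝ] E :=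
  LinearMap.mkContinuous
    { toFun := (InnerProductSpace.toDual ℝ E).symm
      map_add' := map_add _
      map_smul' := fun c x => by simp } 1 fun x => by simp

@[simp]
theorem inner_riesz (ℓ : StrongDual ℝ E) (x : E) : ⟪riesz ℓ, x⟫_ℝ = ℓ x :=
  InnerProductSpace.toDual_symm_apply

@[simp]
theorem innerSL_riesz (ℓ : StrongDual ℝ E) : innerSL ℝ (riesz ℓ) = ℓ :=
  ContinuousLinearMap.ext fun x => inner_riesz ℓ x

@[simp]
theorem riesz_innerSL (x : E) : riesz (innerSL ℝ x) = x :=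
  ext_inner_right ℝ fun y => by simp

theorem riesz_injective : Function.Injective (riesz : StrongDual ℝ E → E) :=
  (InnerProductSpace.toDual ℝ E).symm.injective

theorem norm_riesz (ℓ : StrongDual ℝ E) : ‖riesz ℓ‖ = ‖ℓ‖ :=
  (InnerProductSpace.toDual ℝ E).symm.norm_map ℓ

/-- Restriction of functionals along `j`. -/
noncomputable def dualComp {P H : Type*} [NormedAddCommGroup P] [NormedSpace ℝ P]
    [NormedAddCommGroup H] [NormedSpace ℝ H] (j : P →L[ℝ] H) :
    StrongDual ℝ H →L[ℝ] StrongDual ℝ P :=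
  (ContinuousLinearMap.compL ℝ P H ℝ).flip j

@[simp]
theorem dualComp_apply {P H : Type*} [NormedAddCommGroup P] [NormedSpace ℝ P]
    [NormedAddCommGroup H] [NormedSpace ℝ H] (j : P →L[ℝ] H) (ℓ : StrongDual ℝ H) :
    dualComp j ℓ = ℓ.comp j := rfl

/-- The Riesz embedding of a real Hilbert space into its dual, as a linear map. -/
noncomputable def innerCLM : E →L[ℝ] StrongDual ℝ E :=
  LinearMap.mkContinuous
    { toFun := fun x => innerSL ℝ x
      map_add' := map_add _
      map_smul' := fun c x => by ext; simp } 1 fun x => by simp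

/-- The embedding `pivot` as a continuous linear map. -/
noncomputable def pivotCLM (j : F →L[ℝ] E) : E →L[ℝ] StrongDual ℝ F :=
  (dualComp j).comp innerCLM

/-- The adjoint of an operator that is bounded below has a right inverse with values in the
orthogonal complement of its kernel. -/
theorem exists_rightInverse_adjoint (C : E →L[ℝ] F) {c : ℝ} (hc : 0 < c)
    (hC : ∀ x, c * ‖x‖ ≤ ‖C x‖) :
    ∃ R : E →L[ℝ] F, (∀ y, C.adjoint (R y) = y) ∧ ∀ y v, C.adjoint v = 0 → ⟪R y, v⟫_ℝ = 0 := by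
  -- C*C is coercive with constant c², hence invertible. The right inverse is C(C*C)⁻¹, whose values
  -- lie in the range of C and so are orthogonal to ker C*.
  have hunit : IsUnit (C.adjoint.comp C) := by
    refine ContinuousLinearMap.isUnit_of_forall_le_norm_inner_map (c := ⟨c ^ 2, sq_nonneg c⟩) _
      (pow_pos hc 2 : (0 : ℝ) < c ^ 2) fun x => ?_
    rw [ContinuousLinearMap.comp_apply, ContinuousLinearMap.adjoint_inner_left,
      real_inner_self_eq_norm_sq, norm_pow, norm_norm]
    have := pow_le_pow_left₀ (by positivity) (hC x) 2
    change ‖x‖ ^ 2 * c ^ 2 ≤ _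
    linarith [mul_pow c ‖x‖ 2]
  obtain ⟨u, hu⟩ := hunit
  refine ⟨C.comp (↑u⁻¹ : E →L[ℝ] E), fun y => ?_, fun y v hv => ?_⟩
  · have h1 : (C.adjoint.comp C) ((↑u⁻¹ : E →L[ℝ] E) y) = y := by
      rw [← hu, ← mul_apply_eq_comp, Units.mul_inv, one_apply_eq_self]
    exact h1
  · rw [ContinuousLinearMap.comp_apply, ← ContinuousLinearMap.adjoint_inner_right, hv,
      inner_zero_right]

variable {P H M Q : Type*}
  [NormedAddCommGroup P] [InnerProductSpace ℝ P] [CompleteSpace P]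
  [NormedAddCommGroup H] [InnerProductSpace ℝ H] [CompleteSpace H]
  [NormedAddCommGroup M] [InnerProductSpace ℝ M] [CompleteSpace M]
  [NormedAddCommGroup Q] [InnerProductSpace ℝ Q] [CompleteSpace Q]

theorem mem_kerB {B : P →L[ℝ] StrongDual ℝ Q} {q : P} : q ∈ kerB B ↔ B q = 0 := LinearMap.mem_ker

theorem isClosed_kerB (B : P →L[ℝ] StrongDual ℝ Q) : IsClosed (kerB B : Set P) :=
  B.isClosed_ker

theorem InfSup.le_norm_flip {B : P →L[ℝ] StrongDual ℝ Q} {β : ℝ} (hB : InfSup B β) (μ : Q) :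
    β * ‖μ‖ ≤ ‖B.flip μ‖ := by
  rcases eq_or_ne μ 0 with rfl | hμ
  · simp
  have hμ' : 0 < ‖μ‖ := norm_pos_iff.2 hμ
  rw [← le_div_iff₀ hμ']
  -- Nonnegativity of the bound is needed because the supremum is 0 by convention when P is trivial.
  refine (hB μ hμ).trans (Real.iSup_le (fun q => ?_) (by positivity))
  have hq : 0 < ‖(q : P)‖ := norm_pos_iff.2 q.2
  rw [div_le_div_iff₀ (by positivity) hμ']
  have h1 : B q μ ≤ ‖B.flip μ‖ * ‖(q : P)‖ := (le_abs_self _).trans ((B.flip μ).le_opNorm q)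
  nlinarith [mul_le_mul_of_nonneg_right h1 hμ'.le]

/-- The right inverse of an inf-sup stable `B`, as a continuous linear map on `Q`. -/
theorem InfSup.exists_rightInverse {B : P →L[ℝ] StrongDual ℝ Q} {β : ℝ} (hβ : 0 < β)
    (hB : InfSup B β) :
    ∃ R : Q →L[ℝ] P, (∀ μ, B (R μ) = innerSL ℝ μ) ∧ ∀ μ, R μ ∈ (kerB B)ᗮ := by
  -- Inf-sup stability says that B*: Q → P is bounded below; its adjoint is B up to Riesz.
  obtain ⟨R, hR, hR'⟩ := exists_rightInverse_adjoint (riesz.comp B).adjoint hβ fun μ => by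
    have h1 : innerSL ℝ ((riesz.comp B).adjoint μ) = B.flip μ := by
      ext q
      rw [innerSL_apply_apply, ContinuousLinearMap.adjoint_inner_left, real_inner_comm]
      exact inner_riesz _ _
    have h2 := hB.le_norm_flip μ
    rwa [← h1, innerSL_apply_norm] at h2
  rw [ContinuousLinearMap.adjoint_adjoint] at hR hR'
  refine ⟨R, fun μ => ?_, fun μ => ?_⟩
  · rw [← innerSL_riesz (B (R μ))]
    exact congrArg (innerSL ℝ) (hR μ)
  · rw [Submodule.mem_orthogonal']
    intro q hq
    refine hR' μ q ?_
    rw [ContinuousLinearMap.comp_apply, mem_kerB.1 hq, map_zero]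

/-- Two preimages in the orthogonal complement differ by an element of ker B that is orthogonal to
itself. This identifies the chosen preimage with the bounded operator R. -/
theorem rightInv_eq {B : P →L[ℝ] StrongDual ℝ Q} {η : StrongDual ℝ Q} {q : P}
    (hq : q ∈ (kerB B)ᗮ) (hBq : B q = η) : rightInv B η = q := by
  have h1 : B (rightInv B η) = η :=
    Function.invFun_eq (f := fun q : (kerB B)ᗮ => B (q : P)) ⟨⟨q, hq⟩, hBq⟩
  have h2 : rightInv B η ∈ (kerB B)ᗮ := Subtype.property _
  have h3 : rightInv B η - q ∈ kerB B := by rw [mem_kerB, map_sub, h1, hBq, sub_self]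
  have h4 : rightInv B η - q ∈ (kerB B)ᗮ := Submodule.sub_mem _ h2 hq
  exact sub_eq_zero.1 (inner_self_eq_zero (𝕜 := ℝ).1 (h4 _ h3))

/-- Functionals that vanish on `ker B` are in the range of `B*`, with a bounded inverse. -/
theorem exists_leftInverse_flip {B : P →L[ℝ] StrongDual ℝ Q} {R : Q →L[ℝ] P}
    (hR : ∀ μ, B (R μ) = innerSL ℝ μ) :
    ∃ S : StrongDual ℝ P →L[ℝ] Q, ∀ ℓ : StrongDual ℝ P, (∀ q ∈ kerB B, ℓ q = 0) →
      B.flip (S ℓ) = ℓ := by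
  -- The adjoint of R works because q and its lift R(B q) differ by an element of ker B, where ℓ
  -- vanishes.
  refine ⟨R.adjoint.comp riesz, fun ℓ hℓ => ?_⟩
  ext q
  rw [ContinuousLinearMap.flip_apply, ContinuousLinearMap.comp_apply, ← inner_riesz,
    ContinuousLinearMap.adjoint_inner_right, real_inner_comm, inner_riesz]
  have h1 : q - R (riesz (B q)) ∈ kerB B := by
    rw [mem_kerB, map_sub, hR, innerSL_riesz, sub_self]
  have h2 := hℓ _ h1
  rw [map_sub] at h2
  linarith

/-- Functionals on `ker B` are represented through `K*`. -/
theorem exists_rightInverse_flip (K : P →L[ℝ] StrongDual ℝ M) (B : P →L[ℝ] StrongDual ℝ Q)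
    {cK : ℝ} (hcK : 0 < cK) (hK : ∀ q ∈ kerB B, cK * ‖q‖ ≤ ‖K q‖) :
    ∃ S : StrongDual ℝ P →L[ℝ] M, ∀ ℓ : StrongDual ℝ P, ∀ q ∈ kerB B, K q (S ℓ) = ℓ q := by
  have : CompleteSpace (kerB B) := (isClosed_kerB B).completeSpace_coe
  obtain ⟨R, hR, -⟩ := exists_rightInverse_adjoint ((riesz.comp K).comp (kerB B).subtypeL) hcK
    fun q => by
      rw [ContinuousLinearMap.comp_apply, ContinuousLinearMap.comp_apply, norm_riesz]
      exact hK q q.2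
  refine ⟨(R.comp riesz).comp (dualComp (kerB B).subtypeL), fun ℓ q hq => ?_⟩
  have h1 := congrArg (fun x => ⟪x, (⟨q, hq⟩ : kerB B)⟫_ℝ)
    (hR (riesz (dualComp (kerB B).subtypeL ℓ)))
  simp only [inner_riesz] at h1
  rw [ContinuousLinearMap.adjoint_inner_left, real_inner_comm] at h1
  rw [← inner_riesz]
  exact h1

end Operators

/-! ### The skew-adjoint coupling -/

section SaddleRelation

set_option linter.unusedSectionVars false

variable {P H M : Type*}
  [NormedAddCommGroup P] [InnerProductSpace ℝ P] [CompleteSpace P]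
  [NormedAddCommGroup H] [InnerProductSpace ℝ H] [CompleteSpace H]
  [NormedAddCommGroup M] [InnerProductSpace ℝ M] [CompleteSpace M]

/-- The graph of the operator matrix with rows `(0, -k*)` and `(k, 0)`, where `k` is regarded as an
unbounded operator from `H` to `M` with the domain `j(N)`. -/
def saddleRel (j : P →L[ℝ] H) (k : P →L[ℝ] M) (N : Submodule ℝ P) :
    Submodule ℝ (WithLp 2 (H × M) × WithLp 2 (H × M)) where
  carrier := {z | ∃ q ∈ N, j q = z.1.fst ∧ k q = z.2.snd ∧
    ∀ r ∈ N, ⟪z.2.fst, j r⟫_ℝ + ⟪k r, z.1.snd⟫_ℝ = 0}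
  zero_mem' := ⟨0, N.zero_mem, by simp, by simp, by simp⟩
  add_mem' := by
    rintro z w ⟨q, hq, hjq, hkq, hz⟩ ⟨q', hq', hjq', hkq', hw⟩
    refine ⟨q + q', N.add_mem hq hq', by simp [hjq, hjq'], by simp [hkq, hkq'], fun r hr => ?_⟩
    simp only [Prod.fst_add, Prod.snd_add, WithLp.add_fst, WithLp.add_snd, inner_add_left,
      inner_add_right]
    linarith [hz r hr, hw r hr]
  smul_mem' := by
    rintro c z ⟨q, hq, hjq, hkq, hz⟩
    refine ⟨c • q, N.smul_mem c hq, by simp [hjq], by simp [hkq], fun r hr => ?_⟩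
    simp only [Prod.smul_fst, Prod.smul_snd, WithLp.smul_fst, WithLp.smul_snd,
      real_inner_smul_left, real_inner_smul_right]
    rw [← mul_add, hz r hr, mul_zero]

/-- Symmetry is a direct cancellation. For maximality, the lower bound on k makes the range of (j,
k) on N closed, so a double orthogonal complement recovers the element q required for membership. -/
theorem isSkewAdjointRel_saddleRel (j : P →L[ℝ] H) (k : P →L[ℝ] M) (N : Submodule ℝ P)
    (hN : IsClosed (N : Set P)) {c : ℝ} (hc : 0 < c) (hk : ∀ q ∈ N, c * ‖q‖ ≤ ‖k q‖) :
    IsSkewAdjointRel (saddleRel j k N) := by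
  intro y w
  constructor
  · rintro ⟨q, hq, hjq, hkq, h⟩ a b ⟨r, hr, hjr, hkr, h'⟩
    have h1 := h r hr
    have h2 := h' q hq
    simp only at hjq hkq hjr hkr h1 h2
    rw [hjq, hkq, real_inner_comm] at h2
    rw [hjr, hkr] at h1
    simp only [WithLp.prod_inner_apply]
    change ⟪b.fst, y.fst⟫_ℝ + ⟪b.snd, y.snd⟫_ℝ + (⟪a.fst, w.fst⟫_ℝ + ⟪a.snd, w.snd⟫_ℝ) = 0
    rw [real_inner_comm] at h1
    rw [real_inner_comm] at h2
    linarith [real_inner_comm b.fst y.fst, real_inner_comm a.fst w.fst,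
      real_inner_comm b.snd y.snd, real_inner_comm a.snd w.snd]
  · intro h
    have hcN : CompleteSpace N := hN.completeSpace_coe
    let g : N →L[ℝ] WithLp 2 (H × M) :=
      ((WithLp.prodContinuousLinearEquiv 2 ℝ H M).symm : (H × M) →L[ℝ] WithLp 2 (H × M)).comp
        ((j.prod k).comp N.subtypeL)
    have hg1 : ∀ q : N, (g q).fst = j q := fun q => rfl
    have hg2 : ∀ q : N, (g q).snd = k q := fun q => rfl
    have hanti : ∀ q : N, ‖q‖ ≤ c⁻¹ * ‖g q‖ := by
      intro q
      have h1 : ‖k q‖ ≤ ‖g q‖ := by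
        rw [← hg2]
        exact WithLp.norm_snd_le _ _
      rw [← div_eq_inv_mul, le_div_iff₀ hc, mul_comm]
      exact (hk q q.2).trans h1
    have hclosed : IsClosed (g.range : Set (WithLp 2 (H × M))) := by
      have := (AddMonoidHomClass.antilipschitz_of_bound g (K := ⟨c⁻¹, by positivity⟩) hanti)
      exact this.isClosed_range g.uniformContinuous
    have hcr : CompleteSpace g.range := hclosed.completeSpace_coe
    have hmem : WithLp.toLp 2 (y.fst, w.snd) ∈ g.range := by
      rw [← Submodule.orthogonal_orthogonal g.range, Submodule.mem_orthogonal]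
      intro e he
      rw [Submodule.mem_orthogonal'] at he
      -- Orthogonality of e to the range of (j, k) says exactly that this pair lies in the relation.
      have h1 := h (WithLp.toLp 2 (0, e.snd)) (WithLp.toLp 2 (e.fst, 0))
        ⟨0, N.zero_mem, by simp, by simp, fun r hr => by
          have h2 := he (g ⟨r, hr⟩) ⟨_, rfl⟩
          rw [WithLp.prod_inner_apply] at h2
          change ⟪e.fst, j r⟫_ℝ + ⟪k r, e.snd⟫_ℝ = 0
          rw [real_inner_comm e.snd]
          exact h2⟩
      simp only [WithLp.prod_inner_apply, inner_zero_left, add_zero, zero_add] at h1 ⊢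
      exact h1
    obtain ⟨q, hq⟩ := hmem
    have hq' : g q = WithLp.toLp 2 (y.fst, w.snd) := hq
    refine ⟨q, q.2, ?_, ?_, fun r hr => ?_⟩
    · rw [← hg1, hq']; rfl
    · rw [← hg2, hq']; rfl
    · have h1 := h (WithLp.toLp 2 (j r, 0)) (WithLp.toLp 2 (0, k r))
        ⟨r, hr, rfl, rfl, fun s hs => by simp⟩
      simp only [WithLp.prod_inner_apply, inner_zero_left, add_zero, zero_add] at h1
      change ⟪w.fst, j r⟫_ℝ + ⟪k r, y.snd⟫_ℝ = 0
      rw [real_inner_comm]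
      linarith [show ⟪k r, y.snd⟫_ℝ + ⟪j r, w.fst⟫_ℝ = 0 from h1]

end SaddleRelation

/-! ### The system with homogeneous constraint -/

section Reduced

set_option linter.unusedSectionVars false

variable {P H M Q : Type*}
  [NormedAddCommGroup P] [InnerProductSpace ℝ P] [CompleteSpace P]
  [NormedAddCommGroup H] [InnerProductSpace ℝ H] [CompleteSpace H]
  [NormedAddCommGroup M] [InnerProductSpace ℝ M] [CompleteSpace M]
  [NormedAddCommGroup Q] [InnerProductSpace ℝ Q] [CompleteSpace Q]

theorem inner_eq_zero_of_mem_hKer {j : P →L[ℝ] H} {B : P →L[ℝ] StrongDual ℝ Q} {x w : H}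
    (hx : x ∈ hKer j B) (hw : ∀ q ∈ kerB B, ⟪w, j q⟫_ℝ = 0) : ⟪w, x⟫_ℝ = 0 := by
  have hsub : closure ((kerB B).map j.toLinearMap : Set H) ⊆ {x | ⟪w, x⟫_ℝ = 0} := by
    refine closure_minimal ?_ (isClosed_eq (by fun_prop) continuous_const)
    rintro _ ⟨q, hq, rfl⟩
    exact hw q hq
  exact hsub hx

/-- Solvability for right-hand sides in `L²(0, T; H)` and `L²(0, T; M)` and homogeneous
constraint. -/
theorem exists_mild_homogeneous (j : P →L[ℝ] H) (hj : Function.Injective j)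
    (A : H →L[ℝ] StrongDual ℝ H) (K : P →L[ℝ] StrongDual ℝ M) (D : M →L[ℝ] StrongDual ℝ M)
    (B : P →L[ℝ] StrongDual ℝ Q) {cK : ℝ} (hcK : 0 < cK) (hK : ∀ q ∈ kerB B, cK * ‖q‖ ≤ ‖K q‖)
    {T ε : ℝ} (hT : 0 < T) (hε : 0 < ε) {F₁ : ℝ → H} (hF₁ : MemL2 T F₁) {F₂ : ℝ → M}
    (hF₂ : MemL2 T F₂) {p₀ : H} (hp₀ : p₀ ∈ hKer j B) (m₀ : M) :
    ∃ (p : ℝ → H) (m : ℝ → M), ContinuousOn p (Set.Icc 0 T) ∧ ContinuousOn m (Set.Icc 0 T) ∧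
      p 0 = p₀ ∧ m 0 = m₀ ∧ ∀ t ∈ Set.Icc 0 T, ∃ q ∈ kerB B, j q = (∫ s in (0 : ℝ)..t, p s) ∧
        (∀ r ∈ kerB B, ⟪p t - p₀, j r⟫_ℝ + A (∫ s in (0 : ℝ)..t, p s) (j r)
          - K r (∫ s in (0 : ℝ)..t, m s) = ⟪∫ s in (0 : ℝ)..t, F₁ s, j r⟫_ℝ) ∧
        ε • (m t - m₀) + riesz (K q) + riesz (D (∫ s in (0 : ℝ)..t, m s))
          = ∫ s in (0 : ℝ)..t, F₂ s := by
  -- In the unknown (p, √ε m) both off-diagonal entries carry the same factor 1/√ε, so they are skew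
  -- to each other.
  set σ := Real.sqrt ε with hσ
  have hσ0 : 0 < σ := Real.sqrt_pos.2 hε
  have hσσ : σ * σ = ε := Real.mul_self_sqrt hε.le
  let k : P →L[ℝ] M := σ⁻¹ • riesz.comp K
  have hk : ∀ q ∈ kerB B, σ⁻¹ * cK * ‖q‖ ≤ ‖k q‖ := by
    intro q hq
    change _ ≤ ‖σ⁻¹ • riesz (K q)‖
    rw [norm_smul, norm_riesz, Real.norm_of_nonneg (by positivity), mul_assoc]
    exact mul_le_mul_of_nonneg_left (hK q hq) (by positivity)
  have hΓ := isSkewAdjointRel_saddleRel j k (kerB B) (isClosed_kerB B) (by positivity) hk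
  let toZ : (H × M) →L[ℝ] WithLp 2 (H × M) := (WithLp.prodContinuousLinearEquiv 2 ℝ H M).symm
  let ofZ : WithLp 2 (H × M) →L[ℝ] (H × M) := WithLp.prodContinuousLinearEquiv 2 ℝ H M
  let fstZ : WithLp 2 (H × M) →L[ℝ] H := (ContinuousLinearMap.fst ℝ H M).comp ofZ
  let sndZ : WithLp 2 (H × M) →L[ℝ] M := (ContinuousLinearMap.snd ℝ H M).comp ofZ
  let L : WithLp 2 (H × M) →L[ℝ] WithLp 2 (H × M) :=
    toZ.comp (((riesz.comp A).comp fstZ).prod (ε⁻¹ • (riesz.comp D).comp sndZ))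
  have hF : MemL2 T fun t => toZ (F₁ t, σ⁻¹ • F₂ t) := by
    have h1 := (ContinuousLinearMap.inl ℝ H M).comp_memLp' hF₁
    have h2 := (ContinuousLinearMap.inr ℝ H M).comp_memLp' (hF₂.const_smul σ⁻¹)
    have h3 : (fun t => (F₁ t, σ⁻¹ • F₂ t)) = (ContinuousLinearMap.inl ℝ H M ∘ F₁)
        + (ContinuousLinearMap.inr ℝ H M ∘ (σ⁻¹ • F₂)) := by
      ext t <;> simp
    have h4 := h1.add h2
    rw [← h3] at h4
    exact toZ.comp_memLp' h4
  obtain ⟨x, hxc, hx0, hx⟩ := hΓ.exists_mild L hT hF (toZ (p₀, σ • m₀)) (by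
    rintro w ⟨q, hq, hjq, hkq, h⟩
    -- Injectivity of j leaves only H_ker^⊥ × 0 as multivalued part, which is orthogonal to the
    -- consistent initial value.
    have hq0 : q = 0 := hj (by rw [hjq, map_zero]; rfl)
    rw [hq0, map_zero] at hkq
    have h1 : ⟪w.fst, p₀⟫_ℝ = 0 := inner_eq_zero_of_mem_hKer hp₀ fun r hr => by
      simpa using h r hr
    rw [WithLp.prod_inner_apply]
    change ⟪w.fst, p₀⟫_ℝ + ⟪w.snd, σ • m₀⟫_ℝ = 0
    rw [h1, show w.snd = 0 from hkq.symm, inner_zero_left, add_zero])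
  refine ⟨fun t => fstZ (x t), fun t => σ⁻¹ • sndZ (x t), fstZ.continuous.comp_continuousOn hxc,
    (sndZ.continuous.comp_continuousOn hxc).const_smul σ⁻¹, ?_, ?_, fun t ht => ?_⟩
  · change fstZ (x 0) = p₀
    rw [hx0]
    rfl
  · change σ⁻¹ • sndZ (x 0) = m₀
    rw [hx0]
    change σ⁻¹ • σ • m₀ = m₀
    rw [inv_smul_smul₀ hσ0.ne']
  have h0 : (0 : ℝ) ∈ Set.Icc 0 T := ⟨le_rfl, hT.le⟩
  have hxI : IntervalIntegrable x volume 0 t :=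
    intervalIntegrable_of_mem_Icc ((memL2_of_continuousOn hxc).intervalIntegrable hT) h0 ht
  have hFI := intervalIntegrable_of_mem_Icc (hF.intervalIntegrable hT) h0 ht
  obtain ⟨q, hq, hjq, hkq, h⟩ := hx t ht
  have e1 : ∫ s in (0 : ℝ)..t, fstZ (x s) = fstZ (∫ s in (0 : ℝ)..t, x s) :=
    fstZ.intervalIntegral_comp_comm hxI
  have e2 : ∫ s in (0 : ℝ)..t, σ⁻¹ • sndZ (x s) = σ⁻¹ • sndZ (∫ s in (0 : ℝ)..t, x s) := by
    rw [intervalIntegral.integral_smul, sndZ.intervalIntegral_comp_comm hxI]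
  have e3 : ∫ s in (0 : ℝ)..t, F₁ s
      = fstZ (∫ s in (0 : ℝ)..t, toZ (F₁ s, σ⁻¹ • F₂ s)) :=
    fstZ.intervalIntegral_comp_comm hFI
  have e4 : σ⁻¹ • ∫ s in (0 : ℝ)..t, F₂ s
      = sndZ (∫ s in (0 : ℝ)..t, toZ (F₁ s, σ⁻¹ • F₂ s)) := by
    rw [← intervalIntegral.integral_smul]
    exact sndZ.intervalIntegral_comp_comm hFI
  refine ⟨q, hq, by rw [e1]; exact hjq, fun r hr => ?_, ?_⟩
  · have h1 := h r hr
    change ⟪p₀ + fstZ (∫ s in (0 : ℝ)..t, toZ (F₁ s, σ⁻¹ • F₂ s)) - fstZ (x t)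
      - riesz (A (fstZ (∫ s in (0 : ℝ)..t, x s))), j r⟫_ℝ
      + ⟪σ⁻¹ • riesz (K r), sndZ (∫ s in (0 : ℝ)..t, x s)⟫_ℝ = 0 at h1
    rw [inner_sub_left, inner_sub_left, inner_add_left, real_inner_smul_left, inner_riesz,
      inner_riesz, ← e3, ← e1] at h1
    rw [e2, map_smul, inner_sub_left, smul_eq_mul]
    linarith
  · change σ⁻¹ • riesz (K q) = σ • m₀ + sndZ (∫ s in (0 : ℝ)..t, toZ (F₁ s, σ⁻¹ • F₂ s))
      - sndZ (x t) - ε⁻¹ • riesz (D (sndZ (∫ s in (0 : ℝ)..t, x s))) at hkq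
    rw [← e4] at hkq
    have h1 := congrArg (fun z => σ • z) hkq
    simp only [smul_sub, smul_add, smul_inv_smul₀ hσ0.ne', smul_smul, hσσ] at h1
    rw [h1, e2, map_smul, map_smul, smul_sub, smul_smul]
    have h2 : ε * σ⁻¹ = σ := by rw [← hσσ]; field_simp
    have h3 : σ * ε⁻¹ = σ⁻¹ := by rw [← hσσ]; field_simp
    rw [h2, h3]
    abel

end Reduced

/-! ### Lifting the constraint and the rough load -/

section Solution

set_option linter.unusedSectionVars false

theorem MemH1.exists_ae_eq_add_integral {X : Type*} [NormedAddCommGroup X] [NormedSpace ℝ X]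
    [CompleteSpace X] {T : ℝ} (hT : 0 < T) {u : ℝ → X} (hu : MemH1 T u) :
    ∃ (c : X) (v : ℝ → X), MemL2 T v ∧
      ∀ᵐ t ∂volume.restrict (Set.Ioo 0 T), u t = c + ∫ s in (0 : ℝ)..t, v s := by
  obtain ⟨hu2, v, hv, huv⟩ := hu
  obtain ⟨c, hcv⟩ := huv.ae_eq_add_integral hT (hu2.intervalIntegrable hT)
    (hv.intervalIntegrable hT)
  exact ⟨c, v, hv, hcv⟩

/-- The continuous representative of a function in `H¹(0, T; X)` is a primitive. -/
theorem MemH1.exists_eq_add_integral {X : Type*} [NormedAddCommGroup X] [NormedSpace ℝ X]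
    [CompleteSpace X] {T : ℝ} (hT : 0 < T) {u : ℝ → X} (hu : MemH1 T u)
    (hc : ContinuousOn u (Set.Icc 0 T)) :
    ∃ v : ℝ → X, MemL2 T v ∧ ∀ t ∈ Set.Icc 0 T, u t = u 0 + ∫ s in (0 : ℝ)..t, v s := by
  obtain ⟨c, v, hv, hcv⟩ := hu.exists_ae_eq_add_integral hT
  rw [restrict_Ioo_eq_restrict_Icc] at hcv
  have h1 := Measure.eqOn_Icc_of_ae_eq volume hT.ne hcv hc
    (continuousOn_const.add (continuousOn_integral_Icc hT (hv.intervalIntegrable hT)))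
  refine ⟨v, hv, fun t ht => ?_⟩
  have h0 := h1 ⟨le_rfl, hT.le⟩
  simp only [intervalIntegral.integral_same, add_zero] at h0
  rw [h1 ht, h0]

/-- Continuity on test functions is inherited from integration against `Lam` and differentiation,
whose composition is taken with a minus sign. -/
theorem exists_isDistribDeriv {X : Type*} [NormedAddCommGroup X] [NormedSpace ℝ X] {T : ℝ}
    (hT : 0 < T) {Lam : ℝ → X} (hL : ContinuousOn Lam (Set.Icc 0 T)) :
    ∃ lam : 𝓓'(timeInterval T, X), IsDistribDeriv T lam Lam := by
  have hloc : LocallyIntegrableOn Lam (timeInterval T) volume :=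
    ((hL.integrableOn_Icc (μ := volume)).mono_set Set.Ioo_subset_Icc_self).locallyIntegrableOn
  let Φ : 𝓓(timeInterval T, ℝ) →L[ℝ] X :=
    TestFunction.integralAgainstBilinCLM (ContinuousLinearMap.lsmul ℝ ℝ) volume Lam
  refine ⟨-(Φ.comp (TestFunction.lineDerivCLM ℝ (1 : ℝ))), fun φ => ?_⟩
  change -(Φ (TestFunction.lineDerivCLM ℝ (1 : ℝ) φ)) = _
  rw [TestFunction.integralAgainstBilinCLM_eq_integral hloc, intervalIntegral.integral_of_le hT.le,
    ← restrict_Ioo_eq_restrict_Ioc]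
  congr 1
  have hφ : ∀ t, (TestFunction.lineDerivCLM ℝ (1 : ℝ) φ : 𝓓(timeInterval T, ℝ)) t = deriv φ t := by
    intro t
    rw [TestFunction.lineDerivCLM_apply_of_le (by simp)]
    simpa [lineDeriv] using deriv_comp_const_add (f := φ) t 0
  rw [setIntegral_eq_integral_of_forall_compl_eq_zero]
  · simp only [hφ]
    rfl
  · intro t ht
    rw [← hφ, testFunction_eq_zero _ ht, zero_smul]

theorem MemL2.intervalIntegrable_of_mem {X : Type*} [NormedAddCommGroup X] [NormedSpace ℝ X]
    {T t : ℝ} (hT : 0 < T) {u : ℝ → X} (hu : MemL2 T u) (ht : t ∈ Set.Icc 0 T) :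
    IntervalIntegrable u volume 0 t :=
  intervalIntegrable_of_mem_Icc (hu.intervalIntegrable hT) ⟨le_rfl, hT.le⟩ ht

theorem intervalIntegrable_clm {X Y : Type*} [NormedAddCommGroup X] [NormedSpace ℝ X]
    [NormedAddCommGroup Y] [NormedSpace ℝ Y] (l : X →L[ℝ] Y) {u : ℝ → X} {a b : ℝ}
    (hu : IntervalIntegrable u volume a b) : IntervalIntegrable (fun s => l (u s)) volume a b :=
  ⟨l.integrable_comp hu.1, l.integrable_comp hu.2⟩

variable {P H M Q : Type*}
  [NormedAddCommGroup P] [InnerProductSpace ℝ P] [CompleteSpace P]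
  [NormedAddCommGroup H] [InnerProductSpace ℝ H] [CompleteSpace H]
  [NormedAddCommGroup M] [InnerProductSpace ℝ M] [CompleteSpace M]
  [NormedAddCommGroup Q] [InnerProductSpace ℝ Q] [CompleteSpace Q]

/-- The integrated equations on `(0, t)`. -/
def IntegratedAt (ε : ℝ) (j : P →L[ℝ] H) (A : H →L[ℝ] StrongDual ℝ H)
    (K : P →L[ℝ] StrongDual ℝ M) (D : M →L[ℝ] StrongDual ℝ M) (B : P →L[ℝ] StrongDual ℝ Q)
    (f : ℝ → StrongDual ℝ M) (g : ℝ → StrongDual ℝ P) (h : ℝ → StrongDual ℝ Q)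
    (p₀ : H) (m₀ : M) (p : ℝ → H) (m : ℝ → M) (t : ℝ) : Prop :=
  ∃ Pt : P,
    j Pt = (∫ s in (0 : ℝ)..t, p s) ∧
    (∀ q ∈ kerB B,
      ⟪p t - p₀, j q⟫_ℝ + A (∫ s in (0 : ℝ)..t, p s) (j q) - K q (∫ s in (0 : ℝ)..t, m s)
        = (∫ s in (0 : ℝ)..t, g s) q) ∧
    ε • innerSL ℝ (m t - m₀) + K Pt + D (∫ s in (0 : ℝ)..t, m s) = (∫ s in (0 : ℝ)..t, f s) ∧
    B Pt = ∫ s in (0 : ℝ)..t, h s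

/-- Solvability of the integrated equations. -/
theorem exists_integrated (j : P →L[ℝ] H) (hj : Function.Injective j)
    (A : H →L[ℝ] StrongDual ℝ H) (K : P →L[ℝ] StrongDual ℝ M) (D : M →L[ℝ] StrongDual ℝ M)
    (B : P →L[ℝ] StrongDual ℝ Q) {R : Q →L[ℝ] P} (hR : ∀ μ, B (R μ) = innerSL ℝ μ)
    {cK : ℝ} (hcK : 0 < cK) (hK : ∀ q ∈ kerB B, cK * ‖q‖ ≤ ‖K q‖)
    {T ε : ℝ} (hT : 0 < T) (hε : 0 < ε) {f : ℝ → StrongDual ℝ M} (hf : MemL2 T f)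
    {g₁ : ℝ → StrongDual ℝ P} (hg₁ : MemH1 T g₁) {g₂ : ℝ → StrongDual ℝ H} (hg₂ : MemL2 T g₂)
    {g : ℝ → StrongDual ℝ P} (hg : ∀ t, g t = g₁ t + (g₂ t).comp j)
    {h : ℝ → StrongDual ℝ Q} (hh : MemH1 T h) (hhc : ContinuousOn h (Set.Icc 0 T))
    {p₀ : H} (m₀ : M) (hp₀ : p₀ - j (R (riesz (h 0))) ∈ hKer j B) :
    ∃ (p : ℝ → H) (m : ℝ → M), ContinuousOn p (Set.Icc 0 T) ∧ ContinuousOn m (Set.Icc 0 T) ∧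
      p 0 = p₀ ∧ m 0 = m₀ ∧
      ∀ t ∈ Set.Icc 0 T, IntegratedAt ε j A K D B f g h p₀ m₀ p m t := by
  obtain ⟨S, hS⟩ := exists_rightInverse_flip K B hcK hK
  obtain ⟨h', hh', hhrep⟩ := hh.exists_eq_add_integral hT hhc
  obtain ⟨c, g₁', hg₁', hgrep⟩ := hg₁.exists_ae_eq_add_integral hT
  have hg₁'I := hg₁'.intervalIntegrable hT
  have hh2 : MemL2 T h := hh.1
  let G₁ : ℝ → StrongDual ℝ P := fun t => c + ∫ s in (0 : ℝ)..t, g₁' s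
  have hG₁c : ContinuousOn G₁ (Set.Icc 0 T) :=
    continuousOn_const.add (continuousOn_integral_Icc hT hg₁'I)
  let E : StrongDual ℝ Q →L[ℝ] P := R.comp riesz
  -- On ker B, K* m₁ equals g₁ almost everywhere. Its continuous representative G₁ is used so that
  -- m₁ has an initial value.
  let m₁ : ℝ → M := fun t => S (G₁ t)
  have hm₁c : ContinuousOn m₁ (Set.Icc 0 T) := S.continuous.comp_continuousOn hG₁c
  let a₁ : StrongDual ℝ H →L[ℝ] H := riesz
  let a₂ : StrongDual ℝ Q →L[ℝ] H := (riesz.comp A).comp (j.comp E)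
  let a₃ : StrongDual ℝ Q →L[ℝ] H := j.comp E
  let b₁ : StrongDual ℝ M →L[ℝ] M := riesz
  let b₂ : StrongDual ℝ P →L[ℝ] M := ε • S
  let b₃ : StrongDual ℝ Q →L[ℝ] M := (riesz.comp K).comp E
  let b₄ : StrongDual ℝ P →L[ℝ] M := (riesz.comp D).comp S
  -- These are the loads for p - jEh and m + m₁: g₂ with the lift terms in h and h', then f with ε S
  -- g₁', -KEh and D m₁.
  have hF₁ : MemL2 T fun t => a₁ (g₂ t) - a₂ (h t) - a₃ (h' t) :=
    ((a₁.comp_memLp' hg₂).sub (a₂.comp_memLp' hh2)).sub (a₃.comp_memLp' hh')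
  have hF₂ : MemL2 T fun t => b₁ (f t) + b₂ (g₁' t) - b₃ (h t) + b₄ (G₁ t) :=
    (((b₁.comp_memLp' hf).add (b₂.comp_memLp' hg₁')).sub (b₃.comp_memLp' hh2)).add
      (b₄.comp_memLp' (memL2_of_continuousOn hG₁c))
  obtain ⟨p, m, hpc, hmc, hp0, hm0, hsol⟩ := exists_mild_homogeneous j hj A K D B hcK hK hT hε
    hF₁ hF₂ hp₀ (m₀ + m₁ 0)
  refine ⟨fun t => p t + j (E (h t)), fun t => m t - m₁ t,
    hpc.add ((j.comp E).continuous.comp_continuousOn hhc), hmc.sub hm₁c, ?_, ?_, fun t ht => ?_⟩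
  · change p 0 + j (E (h 0)) = p₀
    rw [hp0]
    exact sub_add_cancel _ _
  · change m 0 - m₁ 0 = m₀
    rw [hm0, add_sub_cancel_right]
  obtain ⟨q, hq, hjq, h1, h2⟩ := hsol t ht
  have hIt := hh2.intervalIntegrable_of_mem hT ht
  have hI't := hh'.intervalIntegrable_of_mem hT ht
  have hg't := hg₁'.intervalIntegrable_of_mem hT ht
  have hGt := (memL2_of_continuousOn hG₁c).intervalIntegrable_of_mem hT ht
  have hft := hf.intervalIntegrable_of_mem hT ht
  have hg₂t := hg₂.intervalIntegrable_of_mem hT ht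
  have hpt := (memL2_of_continuousOn hpc).intervalIntegrable_of_mem hT ht
  have hmt := (memL2_of_continuousOn hmc).intervalIntegrable_of_mem hT ht
  have IF₁ : ∫ s in (0 : ℝ)..t, (a₁ (g₂ s) - a₂ (h s) - a₃ (h' s)) = a₁ (∫ s in (0 : ℝ)..t, g₂ s)
      - a₂ (∫ s in (0 : ℝ)..t, h s) - a₃ (∫ s in (0 : ℝ)..t, h' s) := by
    rw [intervalIntegral.integral_sub ((intervalIntegrable_clm a₁ hg₂t).sub
      (intervalIntegrable_clm a₂ hIt)) (intervalIntegrable_clm a₃ hI't),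
      intervalIntegral.integral_sub (intervalIntegrable_clm a₁ hg₂t)
      (intervalIntegrable_clm a₂ hIt), a₁.intervalIntegral_comp_comm hg₂t,
      a₂.intervalIntegral_comp_comm hIt, a₃.intervalIntegral_comp_comm hI't]
  have IF₂ : ∫ s in (0 : ℝ)..t, (b₁ (f s) + b₂ (g₁' s) - b₃ (h s) + b₄ (G₁ s))
      = b₁ (∫ s in (0 : ℝ)..t, f s) + b₂ (∫ s in (0 : ℝ)..t, g₁' s)
        - b₃ (∫ s in (0 : ℝ)..t, h s) + b₄ (∫ s in (0 : ℝ)..t, G₁ s) := by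
    have i₁ := intervalIntegrable_clm b₁ hft
    have i₂ := intervalIntegrable_clm b₂ hg't
    have i₃ := intervalIntegrable_clm b₃ hIt
    have i₄ := intervalIntegrable_clm b₄ hGt
    rw [intervalIntegral.integral_add ((i₁.add i₂).sub i₃) i₄,
      intervalIntegral.integral_sub (i₁.add i₂) i₃, intervalIntegral.integral_add i₁ i₂,
      b₁.intervalIntegral_comp_comm hft, b₂.intervalIntegral_comp_comm hg't,
      b₃.intervalIntegral_comp_comm hIt, b₄.intervalIntegral_comp_comm hGt]
  have Ip : ∫ s in (0 : ℝ)..t, (p s + j (E (h s)))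
      = (∫ s in (0 : ℝ)..t, p s) + j (E (∫ s in (0 : ℝ)..t, h s)) := by
    have hi : IntervalIntegrable (fun s => j (E (h s))) volume 0 t :=
      intervalIntegrable_clm (j.comp E) hIt
    rw [intervalIntegral.integral_add hpt hi]
    exact congrArg _ ((j.comp E).intervalIntegral_comp_comm hIt)
  have Im : ∫ s in (0 : ℝ)..t, (m s - m₁ s)
      = (∫ s in (0 : ℝ)..t, m s) - S (∫ s in (0 : ℝ)..t, G₁ s) := by
    rw [intervalIntegral.integral_sub hmt (intervalIntegrable_clm S hGt)]
    exact congrArg _ (S.intervalIntegral_comp_comm hGt)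
  have Ig : ∫ s in (0 : ℝ)..t, g s
      = (∫ s in (0 : ℝ)..t, G₁ s) + dualComp j (∫ s in (0 : ℝ)..t, g₂ s) := by
    rw [← (dualComp j).intervalIntegral_comp_comm hg₂t,
      ← intervalIntegral.integral_add hGt (intervalIntegrable_clm (dualComp j) hg₂t),
      intervalIntegral.integral_of_le ht.1, intervalIntegral.integral_of_le ht.1]
    rw [restrict_Ioo_eq_restrict_Ioc] at hgrep
    refine integral_congr_ae ?_
    filter_upwards [ae_restrict_of_ae_restrict_of_subset (Set.Ioc_subset_Ioc_right ht.2) hgrep]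
      with s hs
    rw [hg s, hs, dualComp_apply]
  refine ⟨q + E (∫ s in (0 : ℝ)..t, h s), ?_, fun r hr => ?_, ?_, ?_⟩
  · rw [Ip, map_add, hjq]
  · rw [Ip, Im, Ig]
    have h3 := h1 r hr
    rw [IF₁] at h3
    have h4 : p t + j (E (h t)) - p₀
        = p t - (p₀ - j (R (riesz (h 0)))) + j (E (∫ s in (0 : ℝ)..t, h' s)) := by
      rw [hhrep t ht, map_add, map_add]
      change _ = p t - (p₀ - j (E (h 0))) + _
      abel
    have h5 : a₂ (∫ s in (0 : ℝ)..t, h s) = riesz (A (j (E (∫ s in (0 : ℝ)..t, h s)))) := rfl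
    have h6 : a₃ (∫ s in (0 : ℝ)..t, h' s) = j (E (∫ s in (0 : ℝ)..t, h' s)) := rfl
    have h7 : ⟪a₁ (∫ s in (0 : ℝ)..t, g₂ s), j r⟫_ℝ = (∫ s in (0 : ℝ)..t, g₂ s) (j r) :=
      inner_riesz _ _
    rw [h5, h6] at h3
    simp only [inner_sub_left, inner_riesz, h7] at h3
    change ⟪p t + j (E (h t)) - p₀, j r⟫_ℝ + _ - _ = _
    rw [h4, map_add, map_sub, hS _ r hr]
    simp only [inner_add_left, inner_sub_left, add_apply, dualComp_apply, ContinuousLinearMap.comp_apply]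
    linarith
  · refine riesz_injective ?_
    rw [Im]
    have h3 : m t - m₁ t - m₀ = m t - (m₀ + m₁ 0) - S (∫ s in (0 : ℝ)..t, g₁' s) := by
      have : m₁ t = m₁ 0 + S (∫ s in (0 : ℝ)..t, g₁' s) := by
        change S (c + _) = S (c + _) + _
        rw [intervalIntegral.integral_same, add_zero, map_add]
      rw [this]
      abel
    rw [IF₂] at h2
    have h4 : b₁ (∫ s in (0 : ℝ)..t, f s) = riesz (∫ s in (0 : ℝ)..t, f s) := rfl
    have h5 : b₂ (∫ s in (0 : ℝ)..t, g₁' s) = ε • S (∫ s in (0 : ℝ)..t, g₁' s) := rfl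
    have h6 : b₃ (∫ s in (0 : ℝ)..t, h s) = riesz (K (E (∫ s in (0 : ℝ)..t, h s))) := rfl
    have h7 : b₄ (∫ s in (0 : ℝ)..t, G₁ s) = riesz (D (S (∫ s in (0 : ℝ)..t, G₁ s))) := rfl
    rw [h4, h5, h6, h7] at h2
    have h8 : riesz (∫ s in (0 : ℝ)..t, f s) = ε • (m t - (m₀ + m₁ 0)) + riesz (K q)
        + riesz (D (∫ s in (0 : ℝ)..t, m s)) - ε • S (∫ s in (0 : ℝ)..t, g₁' s)
        + riesz (K (E (∫ s in (0 : ℝ)..t, h s))) - riesz (D (S (∫ s in (0 : ℝ)..t, G₁ s))) := by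
      rw [h2]; abel
    rw [h8, h3, map_add, map_add, map_smul, riesz_innerSL, smul_sub ε (m t - (m₀ + m₁ 0)),
      map_add, map_add, map_sub, map_sub]
    abel
  · rw [map_add, mem_kerB.1 hq, zero_add]
    change B (R (riesz _)) = _
    rw [hR, innerSL_riesz]

end Solution

/-! ### Uniqueness of p and m -/

section Uniqueness

set_option linter.unusedSectionVars false

/-- A continuous function with vanishing primitive vanishes. -/
theorem eqOn_zero_of_integral_eq_zero {X : Type*} [NormedAddCommGroup X] [NormedSpace ℝ X]
    [CompleteSpace X] {T : ℝ} (hT : 0 < T) {u : ℝ → X} (hu : ContinuousOn u (Set.Icc 0 T))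
    (h : ∀ t ∈ Set.Icc 0 T, ∫ s in (0 : ℝ)..t, u s = 0) : ∀ t ∈ Set.Icc 0 T, u t = 0 := by
  have h1 : Set.EqOn u (fun _ => 0) (Set.Ioo 0 T) := by
    intro t ht
    have hev : (fun t => ∫ s in (0 : ℝ)..t, u s) =ᶠ[nhds t] fun _ => 0 :=
      Filter.eventually_of_mem (isOpen_Ioo.mem_nhds ht) fun s hs => h s ⟨hs.1.le, hs.2.le⟩
    exact (hasDerivAt_integral_of_continuousOn hu ht).unique
      ((hasDerivAt_const t (0 : X)).congr_of_eventuallyEq hev)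
  exact h1.of_subset_closure hu continuousOn_const Set.Ioo_subset_Icc_self
    (closure_Ioo hT.ne).ge

variable {P H M Q : Type*}
  [NormedAddCommGroup P] [InnerProductSpace ℝ P] [CompleteSpace P]
  [NormedAddCommGroup H] [InnerProductSpace ℝ H] [CompleteSpace H]
  [NormedAddCommGroup M] [InnerProductSpace ℝ M] [CompleteSpace M]
  [NormedAddCommGroup Q] [InnerProductSpace ℝ Q] [CompleteSpace Q]

/-- Uniqueness of the integrated equations, by the energy estimate for the primitives. -/
theorem eqOn_of_integrated {j : P →L[ℝ] H} {A : H →L[ℝ] StrongDual ℝ H}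
    {K : P →L[ℝ] StrongDual ℝ M} {D : M →L[ℝ] StrongDual ℝ M} {B : P →L[ℝ] StrongDual ℝ Q}
    (hD : ∀ x : M, 0 ≤ D x x) {T ε : ℝ} (hT : 0 < T) (hε : 0 < ε)
    {f : ℝ → StrongDual ℝ M} {g : ℝ → StrongDual ℝ P} {h : ℝ → StrongDual ℝ Q} {p₀ : H} {m₀ : M}
    {p p' : ℝ → H} {m m' : ℝ → M} (hp : ContinuousOn p (Set.Icc 0 T))
    (hm : ContinuousOn m (Set.Icc 0 T)) (hp' : ContinuousOn p' (Set.Icc 0 T))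
    (hm' : ContinuousOn m' (Set.Icc 0 T))
    (hI : ∀ t ∈ Set.Icc 0 T, IntegratedAt ε j A K D B f g h p₀ m₀ p m t)
    (hI' : ∀ t ∈ Set.Icc 0 T, IntegratedAt ε j A K D B f g h p₀ m₀ p' m' t) :
    Set.EqOn p' p (Set.Icc 0 T) ∧ Set.EqOn m' m (Set.Icc 0 T) := by
  let u : ℝ → H := fun t => p' t - p t
  let v : ℝ → M := fun t => m' t - m t
  have hu : ContinuousOn u (Set.Icc 0 T) := hp'.sub hp
  have hv : ContinuousOn v (Set.Icc 0 T) := hm'.sub hm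
  let U : ℝ → H := fun t => ∫ s in (0 : ℝ)..t, u s
  let V : ℝ → M := fun t => ∫ s in (0 : ℝ)..t, v s
  have hUc : ContinuousOn U (Set.Icc 0 T) :=
    continuousOn_integral_Icc hT ((memL2_of_continuousOn hu).intervalIntegrable hT)
  have hVc : ContinuousOn V (Set.Icc 0 T) :=
    continuousOn_integral_Icc hT ((memL2_of_continuousOn hv).intervalIntegrable hT)
  have hder : ∀ t ∈ Set.Ioo 0 T, HasDerivAt (fun t => ‖U t‖ ^ 2 + ε * ‖V t‖ ^ 2)
      (2 * ⟪U t, u t⟫_ℝ + ε * (2 * ⟪V t, v t⟫_ℝ)) t := fun t ht =>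
    (hasDerivAt_integral_of_continuousOn hu ht).norm_sq.add
      ((hasDerivAt_integral_of_continuousOn hv ht).norm_sq.const_mul ε)
  -- The first difference equation is tested with a' - a, a preimage of U t in ker B, the second
  -- with V t; the two coupling terms cancel.
  have hpow : ∀ t ∈ Set.Icc 0 T, ⟪U t, u t⟫_ℝ + ε * ⟪V t, v t⟫_ℝ
      = -(A (U t) (U t)) - D (V t) (V t) := by
    intro t ht
    obtain ⟨a, ha, h1, h2, h3⟩ := hI t ht
    obtain ⟨a', ha', h1', h2', h3'⟩ := hI' t ht
    have hU : U t = (∫ s in (0 : ℝ)..t, p' s) - ∫ s in (0 : ℝ)..t, p s :=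
      intervalIntegral.integral_sub ((memL2_of_continuousOn hp').intervalIntegrable_of_mem hT ht)
        ((memL2_of_continuousOn hp).intervalIntegrable_of_mem hT ht)
    have hV : V t = (∫ s in (0 : ℝ)..t, m' s) - ∫ s in (0 : ℝ)..t, m s :=
      intervalIntegral.integral_sub ((memL2_of_continuousOn hm').intervalIntegrable_of_mem hT ht)
        ((memL2_of_continuousOn hm).intervalIntegrable_of_mem hT ht)
    have hq : a' - a ∈ kerB B := by rw [mem_kerB, map_sub, h3, h3', sub_self]
    have hjq : j (a' - a) = U t := by rw [map_sub, ha, ha', hU]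
    have e1 : ⟪u t, U t⟫_ℝ + A (U t) (U t) - K (a' - a) (V t) = 0 := by
      have k1 := h1 _ hq
      have k2 := h1' _ hq
      rw [hjq] at k1 k2
      have k3 : ⟪u t, U t⟫_ℝ = ⟪p' t - p₀, U t⟫_ℝ - ⟪p t - p₀, U t⟫_ℝ := by
        rw [← inner_sub_left]
        congr 1
        change p' t - p t = _
        abel
      have k4 : A (U t) (U t) = A (∫ s in (0 : ℝ)..t, p' s) (U t)
          - A (∫ s in (0 : ℝ)..t, p s) (U t) := by
        rw [← sub_apply, ← map_sub, ← hU]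
      have k5 : K (a' - a) (V t) = K (a' - a) (∫ s in (0 : ℝ)..t, m' s)
          - K (a' - a) (∫ s in (0 : ℝ)..t, m s) := by
        rw [← map_sub, ← hV]
      rw [k3, k4, k5]
      linarith
    have e2 : ε * ⟪v t, V t⟫_ℝ + K (a' - a) (V t) + D (V t) (V t) = 0 := by
      have k1 := congrArg (fun ℓ : StrongDual ℝ M => ℓ (V t)) (h2'.trans h2.symm)
      simp only [add_apply, smul_apply, innerSL_apply_apply, smul_eq_mul] at k1
      have k3 : ⟪v t, V t⟫_ℝ = ⟪m' t - m₀, V t⟫_ℝ - ⟪m t - m₀, V t⟫_ℝ := by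
        rw [← inner_sub_left]
        congr 1
        change m' t - m t = _
        abel
      have k4 : D (V t) (V t) = D (∫ s in (0 : ℝ)..t, m' s) (V t)
          - D (∫ s in (0 : ℝ)..t, m s) (V t) := by
        rw [← sub_apply, ← map_sub, ← hV]
      have k5 : K (a' - a) (V t) = K a' (V t) - K a (V t) := by
        rw [map_sub, sub_apply]
      rw [k3, k4, k5]
      linarith
    rw [real_inner_comm, real_inner_comm (v t)]
    linarith
  have hzero : ∀ t ∈ Set.Icc 0 T, U t = 0 ∧ V t = 0 := by
    intro t ht
    have hgr := le_exp_mul_add_integral (T := T) (ω := 2 * ‖A‖) (by positivity)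
      (y := fun t => ‖U t‖ ^ 2 + ε * ‖V t‖ ^ 2) (r := fun _ => 0)
      ((hUc.norm.pow 2).add (continuousOn_const.mul (hVc.norm.pow 2))) hder continuousOn_const
      (fun _ => le_rfl) (fun s hs => ?_) ht
    · have hU0 : U 0 = 0 := intervalIntegral.integral_same
      have hV0 : V 0 = 0 := intervalIntegral.integral_same
      have h1 : ‖U t‖ ^ 2 + ε * ‖V t‖ ^ 2 ≤ 0 := by simpa [hU0, hV0] using hgr
      have h2 := sq_nonneg ‖U t‖
      have h3 := mul_nonneg hε.le (sq_nonneg ‖V t‖)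
      refine ⟨by simpa using (show ‖U t‖ ^ 2 = 0 by linarith), ?_⟩
      have h4 : ε * ‖V t‖ ^ 2 = 0 := by linarith
      simpa [hε.ne'] using h4
    · have h1 := hpow s ⟨hs.1.le, hs.2.le⟩
      have h2 := hD (V s)
      have h3 : -(A (U s) (U s)) ≤ ‖A‖ * ‖U s‖ * ‖U s‖ :=
        (neg_le_abs _).trans (A.le_opNorm₂ _ _)
      have h4 : 0 ≤ ‖A‖ * (ε * ‖V s‖ ^ 2) := by positivity
      change 2 * ⟪U s, u s⟫_ℝ + ε * (2 * ⟪V s, v s⟫_ℝ)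
        ≤ 2 * ‖A‖ * (‖U s‖ ^ 2 + ε * ‖V s‖ ^ 2) + 0
      nlinarith
  exact ⟨fun t ht => sub_eq_zero.1
      (eqOn_zero_of_integral_eq_zero hT hu (fun t ht => (hzero t ht).1) t ht),
    fun t ht => sub_eq_zero.1
      (eqOn_zero_of_integral_eq_zero hT hv (fun t ht => (hzero t ht).2) t ht)⟩

end Uniqueness

/-! ### The time-integrated residual -/

section Multiplier

set_option linter.unusedSectionVars false

variable {P H M Q : Type*}
  [NormedAddCommGroup P] [InnerProductSpace ℝ P] [CompleteSpace P]
  [NormedAddCommGroup H] [InnerProductSpace ℝ H] [CompleteSpace H]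
  [NormedAddCommGroup M] [InnerProductSpace ℝ M] [CompleteSpace M]
  [NormedAddCommGroup Q] [InnerProductSpace ℝ Q] [CompleteSpace Q]

theorem continuousOn_residual {j : P →L[ℝ] H} {A : H →L[ℝ] StrongDual ℝ H}
    {K : P →L[ℝ] StrongDual ℝ M} {T : ℝ} {p : ℝ → H} {m : ℝ → M}
    (hp : ContinuousOn p (Set.Icc 0 T)) (hm : ContinuousOn m (Set.Icc 0 T)) :
    ContinuousOn (fun t => (A (p t)).comp j - K.flip (m t)) (Set.Icc 0 T) :=
  (((dualComp j).comp A).continuous.comp_continuousOn hp).sub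
    (K.flip.continuous.comp_continuousOn hm)

/-- The first equation, integrated in time and restricted to `ker B`. -/
theorem integral_residual_sub_pivot_eq_zero {j : P →L[ℝ] H} {A : H →L[ℝ] StrongDual ℝ H}
    {K : P →L[ℝ] StrongDual ℝ M} {D : M →L[ℝ] StrongDual ℝ M} {B : P →L[ℝ] StrongDual ℝ Q}
    {T ε : ℝ} (hT : 0 < T)
    {f : ℝ → StrongDual ℝ M} {g : ℝ → StrongDual ℝ P} {h : ℝ → StrongDual ℝ Q} {p₀ : H} {m₀ : M}
    {p : ℝ → H} {m : ℝ → M} (hp : ContinuousOn p (Set.Icc 0 T))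
    (hm : ContinuousOn m (Set.Icc 0 T)) (hg : MemL2 T g) {t : ℝ} (ht : t ∈ Set.Icc 0 T)
    (hI : IntegratedAt ε j A K D B f g h p₀ m₀ p m t) {q : P} (hq : q ∈ kerB B) :
    (pivot j p₀ + (∫ s in (0 : ℝ)..t, (g s - ((A (p s)).comp j - K.flip (m s))))
      - pivot j (p t)) q = 0 := by
  obtain ⟨a, ha, h1, h2, h3⟩ := hI
  have hpI := (memL2_of_continuousOn hp).intervalIntegrable_of_mem hT ht
  have hmI := (memL2_of_continuousOn hm).intervalIntegrable_of_mem hT ht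
  have hgI := hg.intervalIntegrable_of_mem hT ht
  have hA : IntervalIntegrable (fun s => (A (p s)).comp j) volume 0 t :=
    intervalIntegrable_clm ((dualComp j).comp A) hpI
  have hK := intervalIntegrable_clm K.flip hmI
  have eA : ∫ s in (0 : ℝ)..t, (A (p s)).comp j = (A (∫ s in (0 : ℝ)..t, p s)).comp j :=
    ((dualComp j).comp A).intervalIntegral_comp_comm hpI
  rw [intervalIntegral.integral_sub hgI (hA.sub hK), intervalIntegral.integral_sub hA hK, eA,
    K.flip.intervalIntegral_comp_comm hmI]
  have k1 := h1 q hq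
  rw [inner_sub_left] at k1
  change ⟪p₀, j q⟫_ℝ + ((∫ s in (0 : ℝ)..t, g s) q - (A (∫ s in (0 : ℝ)..t, p s) (j q)
    - K q (∫ s in (0 : ℝ)..t, m s))) - ⟪p t, j q⟫_ℝ = 0
  linarith

end Multiplier

end PDAE

/-! ### Assembly: multiplier, regularity and uniqueness -/

theorem proposition2p5
    {P H M Q : Type*}
    [NormedAddCommGroup P] [InnerProductSpace ℝ P] [CompleteSpace P]
    [NormedAddCommGroup H] [InnerProductSpace ℝ H] [CompleteSpace H]
    [NormedAddCommGroup M] [InnerProductSpace ℝ M] [CompleteSpace M]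
    [NormedAddCommGroup Q] [InnerProductSpace ℝ Q] [CompleteSpace Q]
    -- the dense embedding of `P` into the pivot space `H`
    (j : P →L[ℝ] H) (hj : Function.Injective j) (hj_dense : DenseRange j)
    (A : H →L[ℝ] StrongDual ℝ H) (K : P →L[ℝ] StrongDual ℝ M)
    (D : M →L[ℝ] StrongDual ℝ M) (B : P →L[ℝ] StrongDual ℝ Q)
    (cD : ℝ) (hcD : 0 < cD) (hD : ∀ x : M, cD * ‖x‖ ^ 2 ≤ D x x)
    (β : ℝ) (hβ : 0 < β) (hB : PDAE.InfSup B β)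
    (cK : ℝ) (hcK : 0 < cK) (hK : ∀ q ∈ PDAE.kerB B, cK * ‖q‖ ≤ ‖K q‖)
    (T : ℝ) (hT : 0 < T) (ε : ℝ) (hε : 0 < ε)
    (f : ℝ → StrongDual ℝ M) (hf : PDAE.MemL2 T f)
    (g₁ : ℝ → StrongDual ℝ P) (hg₁ : PDAE.MemH1 T g₁)
    (g₂ : ℝ → StrongDual ℝ H) (hg₂ : PDAE.MemL2 T g₂)
    (g : ℝ → StrongDual ℝ P) (hg : ∀ t, g t = g₁ t + (g₂ t).comp j)
    -- `h` is the continuous representative of an element of `H¹(0, T; Q*)`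
    (h : ℝ → StrongDual ℝ Q) (hh : PDAE.MemH1 T h) (hh_cont : ContinuousOn h (Set.Icc 0 T))
    (p₀ : H) (m₀ : M) (hp₀ : p₀ - j (PDAE.rightInv B (h 0)) ∈ PDAE.hKer j B) :
    ∃ (p : ℝ → H) (m : ℝ → M) (lam : 𝓓'(PDAE.timeInterval T, Q)),
      PDAE.IsMildSolution T ε j A K D B f g h p₀ m₀ p m lam ∧
      -- `p ∈ C([0, T], H) ∩ H¹(0, T; P_ker*)` and `m ∈ C([0, T], M)`
      ContinuousOn p (Set.Icc 0 T) ∧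
      PDAE.MemH1 T (fun t => (PDAE.pivot j (p t)).comp (PDAE.kerB B).subtypeL) ∧
      ContinuousOn m (Set.Icc 0 T) ∧
      -- `lam` has a primitive in `C([0, T], Q)`
      (∃ Lam : ℝ → Q, ContinuousOn Lam (Set.Icc 0 T) ∧ PDAE.IsDistribDeriv T lam Lam) ∧
      -- `p' + B* lam ∈ L²(0, T; P*)`
      (∃ r : ℝ → StrongDual ℝ P, PDAE.MemL2 T r ∧
        ∀ φ : 𝓓(PDAE.timeInterval T, ℝ),
          -(∫ t in (0 : ℝ)..T, deriv φ t • PDAE.pivot j (p t)) + B.flip (lam φ)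
            = ∫ t in (0 : ℝ)..T, φ t • r t) ∧
      -- uniqueness
      ∀ (p' : ℝ → H) (m' : ℝ → M) (lam' : 𝓓'(PDAE.timeInterval T, Q)),
        PDAE.IsMildSolution T ε j A K D B f g h p₀ m₀ p' m' lam' →
          Set.EqOn p' p (Set.Icc 0 T) ∧ Set.EqOn m' m (Set.Icc 0 T) ∧ lam' = lam := by
  obtain ⟨R, hR, hR'⟩ := hB.exists_rightInverse hβ
  have hRinv : PDAE.rightInv B (h 0) = R (PDAE.riesz (h 0)) :=
    PDAE.rightInv_eq (hR' _) (by rw [hR, PDAE.innerSL_riesz])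
  rw [hRinv] at hp₀
  obtain ⟨p, m, hpc, hmc, hp0, hm0, hI⟩ := PDAE.exists_integrated j hj A K D B hR hcK hK hT hε hf
    hg₁ hg₂ hg hh hh_cont m₀ hp₀
  obtain ⟨S, hS⟩ := PDAE.exists_leftInverse_flip hR
  have hgL : PDAE.MemL2 T g := by
    rw [show g = fun t => g₁ t + PDAE.dualComp j (g₂ t) from funext hg]
    exact MemLp.add hg₁.1 ((PDAE.dualComp j).comp_memLp' hg₂)
  have hresc := PDAE.continuousOn_residual (j := j) (A := A) (K := K) hpc hmc
  have hresL := PDAE.memL2_of_continuousOn hresc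
  let G : ℝ → StrongDual ℝ P := fun t => g t - ((A (p t)).comp j - K.flip (m t))
  have hGL : PDAE.MemL2 T G := MemLp.sub hgL hresL
  have hGI := hGL.intervalIntegrable hT
  let W : ℝ → StrongDual ℝ P := fun t => PDAE.pivot j p₀ + ∫ s in (0 : ℝ)..t, G s
  have hWc : ContinuousOn W (Set.Icc 0 T) :=
    continuousOn_const.add (PDAE.continuousOn_integral_Icc hT hGI)
  have hpivc : ContinuousOn (fun t => PDAE.pivot j (p t)) (Set.Icc 0 T) :=
    (PDAE.pivotCLM j).continuous.comp_continuousOn hpc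
  have hW : PDAE.HasWeakDeriv T W G :=
    PDAE.hasWeakDeriv_of_eqOn hT hGI (ae_of_all _ fun t => rfl)
  -- S inverts B* on functionals vanishing on ker B, and the integrated residual W - p is one; so B*
  -- Lam + p = W, with weak derivative G.
  let Lam : ℝ → Q := fun t => S (W t - PDAE.pivot j (p t))
  have hLamc : ContinuousOn Lam (Set.Icc 0 T) := S.continuous.comp_continuousOn (hWc.sub hpivc)
  have hker : ∀ t ∈ Set.Icc 0 T, ∀ q ∈ PDAE.kerB B, (W t - PDAE.pivot j (p t)) q = 0 :=
    fun t ht q hq => PDAE.integral_residual_sub_pivot_eq_zero hT hpc hmc hgL ht (hI t ht) hq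
  have hBLam : ∀ t ∈ Set.Icc 0 T, B.flip (Lam t) = W t - PDAE.pivot j (p t) := fun t ht =>
    hS _ (hker t ht)
  obtain ⟨lam, hlam⟩ := PDAE.exists_isDistribDeriv hT hLamc
  have hint : ∀ {X : Type _} [NormedAddCommGroup X] [NormedSpace ℝ X] {u : ℝ → X} {φ : ℝ → ℝ},
      Continuous φ → ContinuousOn u (Set.Icc 0 T) →
      IntervalIntegrable (fun t => φ t • u t) volume 0 T := fun hφ hu =>
    ContinuousOn.intervalIntegrable (by rw [Set.uIcc_of_le hT.le]; exact hφ.continuousOn.smul hu)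
  have hmom : ∀ φ : 𝓓(PDAE.timeInterval T, ℝ),
      -(∫ t in (0 : ℝ)..T, deriv φ t • PDAE.pivot j (p t)) + B.flip (lam φ)
        = ∫ t in (0 : ℝ)..T, φ t • G t := by
    intro φ
    have hφ := PDAE.testFunction_continuous_deriv φ
    have h1 : B.flip (∫ t in (0 : ℝ)..T, deriv φ t • Lam t)
        = (∫ t in (0 : ℝ)..T, deriv φ t • W t)
          - ∫ t in (0 : ℝ)..T, deriv φ t • PDAE.pivot j (p t) := by
      rw [← B.flip.intervalIntegral_comp_comm (ContinuousOn.intervalIntegrable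
          (by rw [Set.uIcc_of_le hT.le]; exact hφ.continuousOn.smul hLamc)),
        ← intervalIntegral.integral_sub (hint hφ hWc) (hint hφ hpivc)]
      refine intervalIntegral.integral_congr fun t ht => ?_
      rw [Set.uIcc_of_le hT.le] at ht
      simp only [map_smul, hBLam t ht, smul_sub]
    rw [hlam φ, map_neg, h1, hW φ]
    abel
  have hsplit : ∀ φ : 𝓓(PDAE.timeInterval T, ℝ), ∫ t in (0 : ℝ)..T, φ t • G t
      = (∫ t in (0 : ℝ)..T, φ t • g t)
        - ∫ t in (0 : ℝ)..T, φ t • ((A (p t)).comp j - K.flip (m t)) := by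
    intro φ
    rw [← intervalIntegral.integral_sub
      ((hgL.intervalIntegrable hT).continuousOn_smul φ.continuous.continuousOn)
      (hint φ.continuous hresc)]
    simp only [G, smul_sub]
  refine ⟨p, m, lam, ⟨hpc, hmc, hp0, hm0, hI, fun φ => ?_⟩, hpc, ?_, hmc, ⟨Lam, hLamc, hlam⟩,
    ⟨G, hGL, hmom⟩, fun p' m' lam' hsol => ?_⟩
  · have h1 := hmom φ
    rw [hsplit φ] at h1
    rw [add_right_comm, h1, sub_add_cancel]
  -- Restriction to ker B removes B* Lam, so there p coincides with W, a primitive of an L²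
  -- function.
  · let ρ := PDAE.dualComp (PDAE.kerB B).subtypeL
    have hρG : PDAE.MemL2 T fun t => ρ (G t) := ρ.comp_memLp' hGL
    refine ⟨PDAE.memL2_of_continuousOn (ρ.continuous.comp_continuousOn hpivc), fun t => ρ (G t),
      hρG, PDAE.hasWeakDeriv_of_eqOn hT (c := ρ (PDAE.pivot j p₀)) (hρG.intervalIntegrable hT) ?_⟩
    filter_upwards [ae_restrict_mem measurableSet_Ioo] with t ht
    have ht' : t ∈ Set.Icc 0 T := ⟨ht.1.le, ht.2.le⟩
    rw [ρ.intervalIntegral_comp_comm (hGL.intervalIntegrable_of_mem hT ht'), ← map_add]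
    ext q
    exact (sub_eq_zero.1 (hker t ht' q q.2)).symm
  · obtain ⟨hpe, hme⟩ := PDAE.eqOn_of_integrated
      (fun x => (by positivity : (0 : ℝ) ≤ cD * ‖x‖ ^ 2).trans (hD x)) hT hε hpc hmc
      hsol.continuousOn_p hsol.continuousOn_m hI hsol.integrated
    refine ⟨hpe, hme, ?_⟩
    -- With p and m fixed, the first equation determines B*(λ φ); inf-sup stability makes B*
    -- injective.
    have hinj : ∀ μ, B.flip μ = 0 → μ = 0 := fun μ hμ => by
      have h1 := hB.le_norm_flip μ
      rw [hμ, norm_zero] at h1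
      exact norm_le_zero_iff.1 (nonpos_of_mul_nonpos_right h1 hβ)
    ext φ
    refine sub_eq_zero.1 (hinj _ ?_)
    have h1 := hmom φ
    rw [hsplit φ] at h1
    have h2 := hsol.multiplier φ
    have e1 : ∫ t in (0 : ℝ)..T, deriv φ t • PDAE.pivot j (p' t)
        = ∫ t in (0 : ℝ)..T, deriv φ t • PDAE.pivot j (p t) :=
      intervalIntegral.integral_congr fun t ht => by
        rw [Set.uIcc_of_le hT.le] at ht
        simp only [hpe ht]
    have e2 : ∫ t in (0 : ℝ)..T, φ t • ((A (p' t)).comp j - K.flip (m' t))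
        = ∫ t in (0 : ℝ)..T, φ t • ((A (p t)).comp j - K.flip (m t)) :=
      intervalIntegral.integral_congr fun t ht => by
        rw [Set.uIcc_of_le hT.le] at ht
        simp only [hpe ht, hme ht]
    rw [e1, e2] at h2
    rw [← h2, add_right_comm, add_sub_cancel_right] at h1
    rw [map_sub, sub_eq_zero]
    exact (add_left_cancel h1).symm
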